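/- Corollary 1. Two networks $l=1,2$ of $n_l$ agents play a stochastic zero-sum game. **Game.** $X_l\subset\mathbb R^{m_l}$ is compact and convex, $\mathbb R^{m_l}$ carries a norm $\|\cdot\|$ with dual norm $\|\cdot\|_*$, and $O_l\supseteq X_l$ is open and convex. Agent $i$ of network $1$ has a cost $f_{1,i}(x_1,x_2)=\mathbb E[\psi_{1,i}(x_1,x_2;\xi)]$ on $O_1\times X_2$, convex in $x_1\in O_1$ and concave in $x_2\in X_2$; agent $j$ of network $2$ has a cost $f_{2,j}(x_1,x_2)=\mathbb E[\psi_{2,j}(x_1,x_2;\xi)]$ on $X_1\times O_2$, convex in $x_2\in O_2$ and concave in $x_1\in X_1$; $\xi$ is a random vector in $\mathbb R^d$. On $X_1\times X_2$, $U:=\frac1{n_1}\sum_i f_{1,i}=-\frac1{n_2}\sum_j f_{2,j}$. There is $L>0$ with $|f_{l,i}(x_1,x_2)-f_{l,i}(x_1',x_2')|\le L(\|x_1-x_1'\|+\|x_2-x_2'\|)$ on the domain of $f_{l,i}$. Partial subdifferentials $\partial_l$ in the variable $x_l$ are taken relative to $O_l$. **Communication.** The edge sets $\mathcal E_l(t)$,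 $t\ge0$, on $\{1,\dots,n_l\}$ contain all loops $(i,i)$, and for some $B_l\ge1$ the union $\bigcup_{t=k}^{k+B_l-1}\mathcal E_l(t)$ is strongly connected for every $k\ge0$. The matrices $W_l(t)=(w_{l,ij}(t))$ are doubly stochastic, with $w_{l,ij}(t)\ge\eta$ if $(j,i)\in\mathcal E_l(t)$ and $w_{l,ij}(t)=0$ otherwise, where $0<\eta<1$. The weights $w_{12,ij}(t)\ge0$ that agent $i$ of network $l$ gives to the agents $j$ of network $3-l$ (positive only along edges of the bipartite graph between the networks) sum to $1$ over $j$. **Algorithm (D-SMD).** $\psi_l$ is a differentiable function on $X_l$ that is $1$-strongly convex with respect to $\|\cdot\|$; its Bregman divergence $D_{\psi_l}(x,p)=\psi_l(x)-\psi_l(p)-\langle\nabla\psi_l(p),x-p\rangle$ is convex in $p$, satisfies $D_{\psi_l}(x_k,x)\to0$ whenever $x_k\to x$ in $X_l$, and $R_1^2:=\sup_{x,x'\in X_1}D_{\psi_1}(x,x')<\infty$. Starting from (possibly random) $x_{l,i}(0)\in X_l$ with $\|x_{l,i}(0)\|\le\Lambda_l$, put, for $t\ge0$, $$v_{l,i}(t)=\sum_j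 w_{l,ij}(t)x_{l,j}(t),\qquad u_{3-l,i}(t)=\sum_j w_{12,ij}(t)x_{3-l,j}(t),$$ $$x_{l,i}(t+1)=\arg\min_{x'\in X_l}\{\alpha(t)\langle\hat g_{l,i}(t),x'-v_{l,i}(t)\rangle+D_{\psi_l}(x',v_{l,i}(t))\},$$ where $\hat g_{l,i}(t)$ is a subgradient in the own variable $x_l$ of $\psi_{l,i}(\cdot,\cdot;\xi_{l,i}(t))$ at own strategy $v_{l,i}(t)$ and opponent strategy $u_{3-l,i}(t)$, and the $\xi_{l,i}(t)$ are i.i.d. copies of $\xi$. Let $\mathcal F_t=\sigma(x_{l,i}(0),\xi_{l,i}(s):l=1,2,\ i\le n_l,\ s<t)$. The $\hat g_{l,i}(t)$ are $\mathcal F_{t+1}$-measurable, and there are $\nu_l>0$ and $g_{1,i}(t)\in\partial_1f_{1,i}(v_{1,i}(t),u_{2,i}(t))$, $g_{2,i}(t)\in\partial_2f_{2,i}(u_{1,i}(t),v_{2,i}(t))$ with $\mathbb E[\hat g_{l,i}(t)\mid\mathcal F_t]=g_{l,i}(t)$ and $\mathbb E[\|g_{l,i}(t)-\hat g_{l,i}(t)\|_*^2\mid\mathcal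 F_t]\le\nu_l^2$. **Claim.** Let $\epsilon\in[0,\frac12)$, let $\alpha(t)=t^{-(1/2+\epsilon)}$ for $t\ge1$, and let $\alpha(0)\ge\alpha(1)$ be arbitrary. Then there is a constant $C$, depending only on $n_l,B_l,\eta,L,\nu_l,\Lambda_l,R_1^2,\epsilon$ and $\alpha(0)$, such that for every agent $i$ of network $1$ and every $T\ge1$ the pseudo regret $$\bar R_1^{(i)}(T)=\mathbb E\Big[\sum_{t=1}^TU(x_{1,i}(t),u_{2,i}(t))\Big]-\min_{x_1\in X_1}\mathbb E\Big[\sum_{t=1}^TU(x_1,u_{2,i}(t))\Big]$$ is well defined (the expectations exist and the minimum is attained) and satisfies $\bar R_1^{(i)}(T)\le C\,T^{1/2+\epsilon}$. In particular, $\bar R_1^{(i)}(T)\le C\sqrt T$ if $\alpha(t)=1/\sqrt t$ for $t\ge1$. -/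

import Mathlib

open MeasureTheory ProbabilityTheory Filter Topology

universe u v w

/-! Throughout, `ℝ^m` with an arbitrary norm is modelled by a finite-dimensional real normed space
`E`; covectors (subgradients) live in the dual `E →L[ℝ] ℝ`, whose operator norm is the dual norm
`‖y‖_* = sup_{‖x‖ ≤ 1} ⟨y, x⟩`. The first space `E` is the one of the network under consideration
("own"), the second space `F` the one of the adversarial network ("opponent"). -/

namespace DSMD

noncomputable section

/-- Bregman divergence `D_ψ(x,p) = ψ(x) - ψ(p) - ⟨∇ψ(p), x - p⟩` for `x, p ∈ X`. The derivative is
the one relative to `X`; on a convex set its value on `x - p` is uniquely determined. -/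
def bregman {E : Type u} [NormedAddCommGroup E] [NormedSpace ℝ E]
    (X : Set E) (ψ : E → ℝ) (x p : E) : ℝ :=
  ψ x - ψ p - fderivWithin ℝ ψ X p (x - p)

/-- `z = P_x(y)`: `z` minimizes `x' ↦ ⟨y, x - x'⟩ + D_ψ(x', x)` over `X`. -/
def IsProx {E : Type u} [NormedAddCommGroup E] [NormedSpace ℝ E]
    (X : Set E) (ψ : E → ℝ) (x : E) (y : E →L[ℝ] ℝ) (z : E) : Prop :=
  z ∈ X ∧ IsMinOn (fun x' => y (x - x') + bregman X ψ x' x) X z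

/-- A differentiable regularizer, 1-strongly convex with respect to the norm, with Bregman divergence
convex in the second argument and satisfying the reciprocity condition. -/
structure IsRegularizer {E : Type u} [NormedAddCommGroup E] [NormedSpace ℝ E]
    (X : Set E) (ψ : E → ℝ) : Prop where
  strong : StrongConvexOn X 1 ψ
  diff : DifferentiableOn ℝ ψ X
  convex_right : ∀ x ∈ X, ConvexOn ℝ X (fun y => bregman X ψ x y)
  reciprocity : ∀ x ∈ X, ∀ z : ℕ → E, (∀ k, z k ∈ X) → Tendsto z atTop (𝓝 x) →
    Tendsto (fun k => bregman X ψ (z k) x) atTop (𝓝 0)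

/-- `g` is a subgradient at `p` of the function `h` with domain `O`. -/
def IsSubgradient {E : Type u} [NormedAddCommGroup E] [NormedSpace ℝ E]
    (O : Set E) (h : E → ℝ) (p : E) (g : E →L[ℝ] ℝ) : Prop :=
  ∀ y ∈ O, h p + g (y - p) ≤ h y

/-- Time-varying communication inside one network; `edge t j i` says that `(j,i)` is an edge at time
`t`, and `W t i j` is the weight that agent `i` gives to agent `j`. Every agent is its own neighbour,
the graphs are uniformly jointly strongly connected over windows of length `B`, and the weights are
doubly stochastic and at least `η` on edges. -/
structure IsMixing {n : ℕ} (edge : ℕ → Fin n → Fin n → Prop)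
    (W : ℕ → Matrix (Fin n) (Fin n) ℝ) (η : ℝ) (B : ℕ) : Prop where
  one_le_B : 1 ≤ B
  self_loop : ∀ t i, edge t i i
  connected : ∀ k i j, Relation.ReflTransGen (fun a b => ∃ t, k ≤ t ∧ t < k + B ∧ edge t a b) i j
  weight_ge : ∀ t i j, edge t j i → η ≤ W t i j
  weight_zero : ∀ t i j, ¬ edge t j i → W t i j = 0
  row_sum : ∀ t i, ∑ j, W t i j = 1
  col_sum : ∀ t j, ∑ i, W t i j = 1

/-- Communication from the `m` agents of the opponent to the `n` agents of a network. -/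
structure IsCrossMixing {n m : ℕ} (edge : ℕ → Fin m → Fin n → Prop)
    (W : ℕ → Matrix (Fin n) (Fin m) ℝ) : Prop where
  nonneg : ∀ t i j, 0 ≤ W t i j
  support : ∀ t i j, 0 < W t i j → edge t j i
  row_sum : ∀ t i, ∑ j, W t i j = 1

/-- The data of one network with `n` agents, facing an opponent with `m` agents: strategy set `X`, an
open domain `O ⊇ X` of the own variable of the costs, regularizer `reg`, communication inside the
network and from the opponent, and the sampled costs `sample i x y ζ` of agent `i`, where `x` is the
own strategy, `y` the strategy of the opponent and `ζ` a value of the random vector. -/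
structure Network (E : Type u) (F : Type v) (n m d : ℕ) where
  X : Set E
  O : Set E
  reg : E → ℝ
  edge : ℕ → Fin n → Fin n → Prop
  W : ℕ → Matrix (Fin n) (Fin n) ℝ
  crossEdge : ℕ → Fin m → Fin n → Prop
  crossW : ℕ → Matrix (Fin n) (Fin m) ℝ
  sample : Fin n → E → F → (Fin d → ℝ) → ℝ

/-- The random sequences of one network: iterates `x`, samples `ξ`, sampled subgradients `gHat` and
subgradients `g` of the expected costs. -/
structure Iterates (Ω : Type w) (E : Type u) [NormedAddCommGroup E] [NormedSpace ℝ E]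
    (n d : ℕ) where
  x : ℕ → Fin n → Ω → E
  ξ : ℕ → Fin n → Ω → (Fin d → ℝ)
  gHat : ℕ → Fin n → Ω → (E →L[ℝ] ℝ)
  g : ℕ → Fin n → Ω → (E →L[ℝ] ℝ)

section OneNetwork

variable {Ω : Type w} [MeasurableSpace Ω]
  {E : Type u} [NormedAddCommGroup E] [NormedSpace ℝ E]
  {F : Type v} [NormedAddCommGroup F] [NormedSpace ℝ F] {n m d : ℕ}

/-- Expected cost of agent `i`: `f_i(x,y) = 𝔼[ψ_i(x,y;ξ)]`. -/
def Network.cost (N : Network E F n m d) (P : Measure Ω) (ξ : Ω → (Fin d → ℝ))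
    (i : Fin n) (x : E) (y : F) : ℝ :=
  ∫ ω, N.sample i x y (ξ ω) ∂P

/-- Average cost of the network. -/
def Network.avgCost (N : Network E F n m d) (P : Measure Ω) (ξ : Ω → (Fin d → ℝ))
    (x : E) (y : F) : ℝ :=
  (1 / (n : ℝ)) * ∑ i, N.cost P ξ i x y

/-- `v_i(t) = ∑_j w_ij(t) x_j(t)`. -/
def Network.v (N : Network E F n m d) (p : Iterates Ω E n d) (t : ℕ) (i : Fin n) (ω : Ω) : E :=
  ∑ j, N.W t i j • p.x t j ω

/-- The weighted information `u_i(t)` that agent `i` receives on the strategies of the opponent. -/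
def Network.u (N : Network E F n m d) (q : Iterates Ω F m d) (t : ℕ) (i : Fin n) (ω : Ω) : F :=
  ∑ j, N.crossW t i j • q.x t j ω

/-- Conditions on the strategy set, the costs and the communication of one network, whose opponent
has the strategy set `Y`. -/
structure Network.IsAdmissible (N : Network E F n m d) (Y : Set F) (P : Measure Ω)
    (ξ : Ω → (Fin d → ℝ)) (η : ℝ) (B : ℕ) (L : ℝ) : Prop where
  X_compact : IsCompact N.X
  X_convex : Convex ℝ N.X
  O_open : IsOpen N.O
  X_subset : N.X ⊆ N.O
  regularizer : IsRegularizer N.X N.reg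
  mixing : IsMixing N.edge N.W η B
  cross : IsCrossMixing N.crossEdge N.crossW
  integrable : ∀ i, ∀ x ∈ N.O, ∀ y ∈ Y, Integrable (fun ω => N.sample i x y (ξ ω)) P
  convex_own : ∀ i, ∀ y ∈ Y, ConvexOn ℝ N.O (fun x => N.cost P ξ i x y)
  concave_opp : ∀ i, ∀ x ∈ N.X, ConcaveOn ℝ Y (fun y => N.cost P ξ i x y)
  lipschitz : ∀ i, ∀ x ∈ N.O, ∀ x' ∈ N.O, ∀ y ∈ Y, ∀ y' ∈ Y,
    |N.cost P ξ i x y - N.cost P ξ i x' y'| ≤ L * (‖x - x'‖ + ‖y - y'‖)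

/-- The sequences of one network are produced by distributed stochastic mirror descent with step sizes
`α`; the opponent's sequences are `q`, and `ℱ t` is the information available at time `t`. -/
structure IsRun [MeasurableSpace E] (N : Network E F n m d) (p : Iterates Ω E n d)
    (q : Iterates Ω F m d) (P : Measure Ω) (ξ : Ω → (Fin d → ℝ)) (α : ℕ → ℝ)
    (ℱ : ℕ → MeasurableSpace Ω) : Prop where
  init_mem : ∀ i ω, p.x 0 i ω ∈ N.X
  init_meas : ∀ i, Measurable (p.x 0 i)
  sample_meas : ∀ t i, Measurable (p.ξ t i)
  sample_law : ∀ t i, IdentDistrib (p.ξ t i) ξ P P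
  gHat_meas : ∀ t i, StronglyMeasurable[ℱ (t + 1)] (p.gHat t i)
  gHat_sub : ∀ t i, ∀ᵐ ω ∂P, IsSubgradient N.O
    (fun x => N.sample i x (N.u q t i ω) (p.ξ t i ω)) (N.v p t i ω) (p.gHat t i ω)
  update : ∀ t i ω,
    IsProx N.X N.reg (N.v p t i ω) (-(α t • p.gHat t i ω)) (p.x (t + 1) i ω)

/-- The sampled subgradients are conditionally unbiased with conditional variance at most `ν²`. -/
structure IsUnbiased (N : Network E F n m d) (p : Iterates Ω E n d)
    (q : Iterates Ω F m d) (P : Measure Ω) (ξ : Ω → (Fin d → ℝ)) (ν : ℝ)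
    (ℱ : ℕ → MeasurableSpace Ω) : Prop where
  g_sub : ∀ t i, ∀ᵐ ω ∂P, IsSubgradient N.O
    (fun x => N.cost P ξ i x (N.u q t i ω)) (N.v p t i ω) (p.g t i ω)
  gHat_int : ∀ t i, Integrable (p.gHat t i) P
  unbiased : ∀ t i, P[p.gHat t i | ℱ t] =ᵐ[P] p.g t i
  sq_int : ∀ t i, Integrable (fun ω => ‖p.g t i ω - p.gHat t i ω‖ ^ 2) P
  variance : ∀ t i, P[fun ω => ‖p.g t i ω - p.gHat t i ω‖ ^ 2 | ℱ t] ≤ᵐ[P] fun _ => ν ^ 2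

end OneNetwork

section TwoNetworks

variable {Ω : Type w} {E₁ : Type u} [NormedAddCommGroup E₁] [NormedSpace ℝ E₁] [MeasurableSpace E₁]
  {E₂ : Type v} [NormedAddCommGroup E₂] [NormedSpace ℝ E₂] [MeasurableSpace E₂] {n₁ n₂ d : ℕ}

/-- `ℱ_t = σ(x_{l,i}(0), ξ_{l,i}(s) : l = 1,2, i ∈ V_l, s < t)`. -/
abbrev info (p₁ : Iterates Ω E₁ n₁ d) (p₂ : Iterates Ω E₂ n₂ d) (t : ℕ) : MeasurableSpace Ω :=
  (⨆ i, MeasurableSpace.comap (p₁.x 0 i) inferInstance) ⊔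
  (⨆ j, MeasurableSpace.comap (p₂.x 0 j) inferInstance) ⊔
  (⨆ s : Fin t, ⨆ i, MeasurableSpace.comap (p₁.ξ s i) inferInstance) ⊔
  (⨆ s : Fin t, ⨆ j, MeasurableSpace.comap (p₂.ξ s j) inferInstance)

/-- The family of all samples, of both networks and at all times. -/
def allSamples (p₁ : Iterates Ω E₁ n₁ d) (p₂ : Iterates Ω E₂ n₂ d) :
    (Fin n₁ ⊕ Fin n₂) × ℕ → Ω → (Fin d → ℝ) :=
  fun a => Sum.elim (p₁.ξ a.2) (p₂.ξ a.2) a.1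

/-- A two-network stochastic zero-sum game together with a run of distributed stochastic mirror
descent with step sizes `α`. The costs of the second network take its own strategy first, so that the
zero-sum condition reads `U(x₁,x₂) = (1/n₁) ∑ f_{1,i} = -(1/n₂) ∑ f_{2,j}`. The constant `R` bounds
the Bregman diameter of the first strategy set and `Λ_l` the norms of the initial points. -/
structure IsGameRun [MeasurableSpace Ω] (N₁ : Network E₁ E₂ n₁ n₂ d) (N₂ : Network E₂ E₁ n₂ n₁ d)
    (p₁ : Iterates Ω E₁ n₁ d) (p₂ : Iterates Ω E₂ n₂ d) (P : Measure Ω) (ξ : Ω → (Fin d → ℝ))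
    (B₁ B₂ : ℕ) (η L ν₁ ν₂ Λ₁ Λ₂ R : ℝ) (α : ℕ → ℝ) : Prop where
  adm₁ : N₁.IsAdmissible N₂.X P ξ η B₁ L
  adm₂ : N₂.IsAdmissible N₁.X P ξ η B₂ L
  zero_sum : ∀ x₁ ∈ N₁.X, ∀ x₂ ∈ N₂.X, N₁.avgCost P ξ x₁ x₂ = -N₂.avgCost P ξ x₂ x₁
  run₁ : IsRun N₁ p₁ p₂ P ξ α (info p₁ p₂)
  run₂ : IsRun N₂ p₂ p₁ P ξ α (info p₁ p₂)
  indep : iIndepFun (allSamples p₁ p₂) P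
  unbiased₁ : IsUnbiased N₁ p₁ p₂ P ξ ν₁ (info p₁ p₂)
  unbiased₂ : IsUnbiased N₂ p₂ p₁ P ξ ν₂ (info p₁ p₂)
  diam : ∀ x ∈ N₁.X, ∀ x' ∈ N₁.X, bregman N₁.X N₁.reg x x' ≤ R
  init₁ : ∀ i ω, ‖p₁.x 0 i ω‖ ≤ Λ₁
  init₂ : ∀ j ω, ‖p₂.x 0 j ω‖ ≤ Λ₂

/-- Cumulated cost `∑_{t=1}^T U(x_{1,i}(t), u_{2,i}(t))` of agent `i` of the first network. -/
def playedCost [MeasurableSpace Ω] (N₁ : Network E₁ E₂ n₁ n₂ d) (p₁ : Iterates Ω E₁ n₁ d)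
    (p₂ : Iterates Ω E₂ n₂ d) (P : Measure Ω) (ξ : Ω → (Fin d → ℝ)) (i : Fin n₁) (T : ℕ) (ω : Ω) : ℝ :=
  ∑ t ∈ Finset.Icc 1 T, N₁.avgCost P ξ (p₁.x t i ω) (N₁.u p₂ t i ω)

/-- Cumulated cost `∑_{t=1}^T U(x₁, u_{2,i}(t))` of the fixed strategy `x₁`. -/
def fixedCost [MeasurableSpace Ω] (N₁ : Network E₁ E₂ n₁ n₂ d)
    (p₂ : Iterates Ω E₂ n₂ d) (P : Measure Ω) (ξ : Ω → (Fin d → ℝ)) (i : Fin n₁) (T : ℕ)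
    (x₁ : E₁) (ω : Ω) : ℝ :=
  ∑ t ∈ Finset.Icc 1 T, N₁.avgCost P ξ x₁ (N₁.u p₂ t i ω)

/-- Pseudo regret of agent `i` of the first network up to time `T`. -/
def pseudoRegret [MeasurableSpace Ω] (N₁ : Network E₁ E₂ n₁ n₂ d) (p₁ : Iterates Ω E₁ n₁ d)
    (p₂ : Iterates Ω E₂ n₂ d) (P : Measure Ω) (ξ : Ω → (Fin d → ℝ)) (i : Fin n₁) (T : ℕ) : ℝ :=
  (∫ ω, playedCost N₁ p₁ p₂ P ξ i T ω ∂P) -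
    sInf ((fun x₁ => ∫ ω, fixedCost N₁ p₂ P ξ i T x₁ ω ∂P) '' N₁.X)

/-- The expectations and the minimum in the definition of the pseudo regret exist. -/
def RegretExists [MeasurableSpace Ω] (N₁ : Network E₁ E₂ n₁ n₂ d) (p₁ : Iterates Ω E₁ n₁ d)
    (p₂ : Iterates Ω E₂ n₂ d) (P : Measure Ω) (ξ : Ω → (Fin d → ℝ)) (i : Fin n₁) (T : ℕ) : Prop :=
  Integrable (playedCost N₁ p₁ p₂ P ξ i T) P ∧
  (∀ x₁ ∈ N₁.X, Integrable (fixedCost N₁ p₂ P ξ i T x₁) P) ∧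
  ∃ z ∈ N₁.X, IsMinOn (fun x₁ => ∫ ω, fixedCost N₁ p₂ P ξ i T x₁ ω ∂P) N₁.X z

end TwoNetworks

/-- With step sizes `α`, the pseudo regret of every agent of the first network is `O(rate T)`, with a
constant that depends only on the displayed parameters: the sizes and connectivity of the networks,
the Lipschitz constant, the noise levels, the bounds on the initial points, the Bregman diameter of
the first strategy set, and the step sizes. -/
def RegretOrder (n₁ n₂ B₁ B₂ : ℕ) (η L ν₁ ν₂ Λ₁ Λ₂ R : ℝ) (α rate : ℕ → ℝ) : Prop :=
  ∃ C : ℝ, ∀ (d : ℕ)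
    (E₁ : Type u) [NormedAddCommGroup E₁] [NormedSpace ℝ E₁] [FiniteDimensional ℝ E₁]
    [MeasurableSpace E₁] [BorelSpace E₁]
    (E₂ : Type v) [NormedAddCommGroup E₂] [NormedSpace ℝ E₂] [FiniteDimensional ℝ E₂]
    [MeasurableSpace E₂] [BorelSpace E₂]
    (Ω : Type w) [MeasurableSpace Ω] (P : Measure Ω) [IsProbabilityMeasure P]
    (ξ : Ω → (Fin d → ℝ))
    (N₁ : Network E₁ E₂ n₁ n₂ d) (N₂ : Network E₂ E₁ n₂ n₁ d)
    (p₁ : Iterates Ω E₁ n₁ d) (p₂ : Iterates Ω E₂ n₂ d),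
    IsGameRun N₁ N₂ p₁ p₂ P ξ B₁ B₂ η L ν₁ ν₂ Λ₁ Λ₂ R α →
    ∀ (i : Fin n₁) (T : ℕ), 1 ≤ T →
      RegretExists N₁ p₁ p₂ P ξ i T ∧ pseudoRegret N₁ p₁ p₂ P ξ i T ≤ C * rate T

end

end DSMD

/-!
The energy of the comparison point `z` is the sum over the agents of the Bregman divergences from
`z` to their states. A mirror step decreases it by `α(t)` times the linearized regret, up to
`α(t)²` times the squared sampled subgradients, and mixing does not increase it, because the
Bregman divergence is convex in its second argument and the weights are doubly stochastic.
Dividing by `α(t)` and summing by parts bounds the linearized regret by the Bregman diameter over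
`α(T)` plus the sum of the step sizes; in expectation the sampled subgradients may be replaced by
the true ones, since they are conditionally unbiased.

What separates the linearized regret from the regret of a single agent is the disagreement within
the two networks, by the Lipschitz bound. Over `n * B` steps every agent receives weight at least
`η ^ (n * B)` from every other one, so the product of the mixing matrices contracts the
disagreement by `1 - η ^ (n * B)` (Doeblin), while each mirror step adds at most `α(t)` times the
dual norms of the sampled subgradients. Hence the accumulated disagreement, and with it the
regret, is controlled by `∑ α(t)` and `1 / α(T)`, both of order `T ^ (1 / 2 + ε)`.
-/

namespace DSMD

section MirrorStep

variable {E : Type u} [NormedAddCommGroup E] [NormedSpace ℝ E] {X : Set E} {ψ : E → ℝ}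

theorem hasFDerivWithinAt_nonneg_of_isMinOn {h : E → ℝ} {h' : E →L[ℝ] ℝ} {z x : E}
    (hX : Convex ℝ X) (hh : HasFDerivWithinAt h h' X z) (hmin : IsMinOn h X z) (hz : z ∈ X)
    (hx : x ∈ X) : 0 ≤ h' (x - z) :=
  hmin.localize.hasFDerivWithinAt_nonneg hh
    (sub_mem_posTangentConeAt_of_segment_subset (hX.segment_subset hz hx))

theorem hasDerivWithinAt_comp_segment (hX : Convex ℝ X) {p x : E}
    (hψ : DifferentiableWithinAt ℝ ψ X p) (hp : p ∈ X) (hx : x ∈ X) :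
    HasDerivWithinAt (fun s : ℝ => ψ (p + s • (x - p))) (fderivWithin ℝ ψ X p (x - p))
      (Set.Icc 0 1) 0 := by
  have hline : HasDerivWithinAt (fun s : ℝ => p + s • (x - p)) (x - p) (Set.Icc 0 1) 0 := by
    simpa using (((hasDerivAt_id (0 : ℝ)).smul_const (x - p)).const_add p).hasDerivWithinAt
  have hψp : HasFDerivWithinAt ψ (fderivWithin ℝ ψ X p) X (p + (0 : ℝ) • (x - p)) := by
    simpa using hψ.hasFDerivWithinAt
  exact hψp.comp_hasDerivWithinAt 0 hline fun s hs => hX.add_smul_sub_mem hp hx hs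

theorem half_mul_sq_norm_le_bregman {m : ℝ} (hψ : StrongConvexOn X m ψ) {p x : E}
    (hd : DifferentiableWithinAt ℝ ψ X p) (hp : p ∈ X) (hx : x ∈ X) :
    m / 2 * ‖x - p‖ ^ 2 ≤ bregman X ψ x p := by
  set c := m / 2 * ‖x - p‖ ^ 2
  -- Strong convexity along the segment from `p` to `x` says that `gap` is minimal at `0`.
  set gap : ℝ → ℝ := fun s => (1 - s) * ψ p + s * ψ x - (1 - s) * s * c - ψ (p + s • (x - p))
  have hmin : IsMinOn gap (Set.Icc 0 1) 0 := fun s hs => by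
    have hconv := hψ.2 hp hx (sub_nonneg.2 hs.2) hs.1 (by ring)
    rw [show (1 - s) • p + s • x = p + s • (x - p) by module, norm_sub_rev p x] at hconv
    simp only [smul_eq_mul] at hconv
    simp only [Set.mem_ofPred_eq, gap, c, zero_smul, add_zero]
    linarith
  have hder : HasDerivWithinAt gap (ψ x - ψ p - c - fderivWithin ℝ ψ X p (x - p))
      (Set.Icc 0 1) 0 := by
    have hid := hasDerivAt_id (0 : ℝ)
    have hid' := hid.const_sub 1
    convert! (((hid'.mul_const (ψ p)).add (hid.mul_const (ψ x))).sub
      ((hid'.mul hid).mul_const c)).hasDerivWithinAt.sub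
        (hasDerivWithinAt_comp_segment hψ.1 hd hp hx) using 1
    simp only [id_eq]
    ring
  have hnonneg := hasFDerivWithinAt_nonneg_of_isMinOn (convex_Icc 0 1) hder.hasFDerivWithinAt hmin
    (Set.left_mem_Icc.2 zero_le_one) (Set.right_mem_Icc.2 zero_le_one)
  simp only [sub_zero, ContinuousLinearMap.toSpanSingleton_apply, one_smul] at hnonneg
  simp only [bregman]
  linarith

theorem IsRegularizer.half_sq_norm_le_bregman (hψ : IsRegularizer X ψ) {p x : E} (hp : p ∈ X)
    (hx : x ∈ X) : 1 / 2 * ‖x - p‖ ^ 2 ≤ bregman X ψ x p :=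
  half_mul_sq_norm_le_bregman hψ.strong (hψ.diff p hp) hp hx

theorem IsRegularizer.bregman_nonneg (hψ : IsRegularizer X ψ) {p x : E} (hp : p ∈ X)
    (hx : x ∈ X) : 0 ≤ bregman X ψ x p :=
  le_trans (by positivity) (hψ.half_sq_norm_le_bregman hp hx)

theorem bregman_self (p : E) : bregman X ψ p p = 0 := by
  simp only [bregman, sub_self, map_zero]

theorem IsProx.three_point (hX : Convex ℝ X) (hψ : DifferentiableOn ℝ ψ X) {p z x : E}
    {y : E →L[ℝ] ℝ} (hz : IsProx X ψ p y z) (hx : x ∈ X) :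
    y (x - z) + bregman X ψ x z + bregman X ψ z p ≤ bregman X ψ x p := by
  set A := y + fderivWithin ℝ ψ X p
  have hder : HasFDerivWithinAt (fun x' => ψ x' - A x') (fderivWithin ℝ ψ X z - A) X z :=
    (hψ z hz.1).hasFDerivWithinAt.sub A.hasFDerivWithinAt
  have hmin : IsMinOn (fun x' => ψ x' - A x') X z := fun x' hx' => by
    have h := hz.2 hx'
    simp only [Set.mem_ofPred_eq, bregman, map_sub, A, _root_.add_apply] at h ⊢
    linarith
  have hfirst := hasFDerivWithinAt_nonneg_of_isMinOn hX hder hmin hz.1 hx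
  simp only [bregman, map_sub, A, _root_.sub_apply, _root_.add_apply] at hfirst ⊢
  linarith

theorem IsProx.eq_of_le (hψ : IsRegularizer X ψ) {p z x : E} {y : E →L[ℝ] ℝ}
    (hz : IsProx X ψ p y z) (hx : x ∈ X)
    (hle : y (p - x) + bregman X ψ x p ≤ y (p - z) + bregman X ψ z p) : x = z := by
  have hthree := hz.three_point hψ.strong.1 hψ.diff hx
  have hquad := hψ.half_sq_norm_le_bregman hz.1 hx
  simp only [map_sub] at hthree hle
  have hsq : ‖x - z‖ ^ 2 ≤ 0 := by linarith
  exact sub_eq_zero.1 (norm_eq_zero.1 (pow_eq_zero_iff two_ne_zero |>.1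
    (hsq.antisymm (sq_nonneg _))))

theorem apply_le_norm_mul (y : E →L[ℝ] ℝ) (x : E) : y x ≤ ‖y‖ * ‖x‖ :=
  (le_abs_self _).trans (y.le_opNorm x)

theorem IsProx.norm_sub_le (hψ : IsRegularizer X ψ) {p z : E} {y : E →L[ℝ] ℝ} (hp : p ∈ X)
    (hz : IsProx X ψ p y z) : ‖z - p‖ ≤ ‖y‖ := by
  have hthree := hz.three_point hψ.strong.1 hψ.diff hp
  have hzp := hψ.half_sq_norm_le_bregman hp hz.1
  have hpz := hψ.half_sq_norm_le_bregman hz.1 hp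
  have hy := apply_le_norm_mul y (z - p)
  rw [bregman_self] at hthree
  rw [norm_sub_rev p z] at hpz
  simp only [map_sub] at hthree hy
  by_contra! hlt
  nlinarith [norm_nonneg y]

theorem IsProx.linear_regret_le (hψ : IsRegularizer X ψ) {p z x : E} {y : E →L[ℝ] ℝ} (hp : p ∈ X)
    (hz : IsProx X ψ p (-y) z) (hx : x ∈ X) :
    y (p - x) ≤ bregman X ψ x p - bregman X ψ x z + 1 / 2 * ‖y‖ ^ 2 := by
  have hthree := hz.three_point hψ.strong.1 hψ.diff hx
  have hzp := hψ.half_sq_norm_le_bregman hp hz.1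
  have hy := apply_le_norm_mul y (p - z)
  have hyoung := sq_nonneg (‖y‖ - ‖z - p‖)
  rw [norm_sub_rev] at hy
  simp only [_root_.neg_apply, map_sub] at hthree hy ⊢
  nlinarith

end MirrorStep

section MeasurableMinimizer

theorem measurable_comp_of_continuousOn {E : Type u} {G : Type v} [TopologicalSpace E]
    [MeasurableSpace E] [BorelSpace E] [TopologicalSpace G] [MeasurableSpace G] [BorelSpace G]
    {X : Set E} {Ω : Type w} {_ : MeasurableSpace Ω} {f : E → G} (hf : ContinuousOn f X)
    {v : Ω → E} (hv : Measurable v) (hvX : ∀ ω, v ω ∈ X) : Measurable fun ω => f (v ω) :=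
  (continuousOn_iff_continuous_domRestrict.1 hf).measurable.comp (hv.subtype_mk (h := hvX))

theorem exists_mem_lt_of_subset_closure {E : Type u} [TopologicalSpace E] {A S : Set E}
    {f : E → ℝ} (hf : ContinuousOn f S) (hA : A ⊆ S) (hS : S ⊆ closure A) {z : E} (hz : z ∈ S)
    {c : ℝ} (hc : f z < c) : ∃ a ∈ A, f a < c := by
  have hlt : ∀ᶠ x in 𝓝[A] z, f x < c := ((hf z hz).mono hA).eventually_lt_const hc
  have : (𝓝[A] z).NeBot := mem_closure_iff_nhdsWithin_neBot.1 (hS hz)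
  obtain ⟨a, ha, haA⟩ := (hlt.and self_mem_nhdsWithin).exists
  exact ⟨a, haA, ha⟩

-- For countable `A` and `D` the right-hand side involves only countably many points, which is what
-- makes `{ω | z ω ∈ K}` measurable when `f` depends on `ω`.
theorem mem_iff_exists_near_minimizer {E : Type u} [TopologicalSpace E] {X K A D : Set E}
    {f : E → ℝ} {z : E} (hXK : IsCompact (X ∩ K)) (hf : ContinuousOn f X) (hz : z ∈ X)
    (hmin : ∀ x ∈ X, f x ≤ f z → x = z) (hAK : A ⊆ X ∩ K) (hKA : X ∩ K ⊆ closure A)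
    (hDX : D ⊆ X) (hXD : X ⊆ closure D) :
    z ∈ K ↔ ∀ k : ℕ, ∃ q ∈ A, ∀ p ∈ D, f q < f p + 1 / ((k : ℝ) + 1) := by
  have hfXK : ContinuousOn f (X ∩ K) := hf.mono Set.inter_subset_left
  constructor
  · intro hzK k
    obtain ⟨q, hqA, hq⟩ := exists_mem_lt_of_subset_closure hfXK hAK hKA ⟨hz, hzK⟩
      (lt_add_of_pos_right (f z) (by positivity : (0 : ℝ) < 1 / ((k : ℝ) + 1)))
    refine ⟨q, hqA, fun p hp => ?_⟩
    have hzp : f z ≤ f p := by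
      by_contra! hlt
      exact hlt.ne (congrArg f (hmin p (hDX hp) hlt.le))
    linarith
  · intro hnear
    obtain ⟨q₀, hq₀, -⟩ := hnear 0
    obtain ⟨q, hq, hqmin⟩ := hXK.exists_isMinOn ⟨q₀, hAK hq₀⟩ hfXK
    have hqz : f q ≤ f z := le_of_forall_pos_lt_add fun ε hε => by
      obtain ⟨k, hk⟩ := exists_nat_one_div_lt (half_pos hε)
      obtain ⟨r, hrA, hr⟩ := hnear k
      obtain ⟨p, hpD, hp⟩ := exists_mem_lt_of_subset_closure hf hDX hXD hz
        (lt_add_of_pos_right (f z) (half_pos hε))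
      have hqr : f q ≤ f r := hqmin (hAK hrA)
      linarith [hr p hpD]
    exact hmin q hq.1 hqz ▸ hq.2

theorem measurable_of_unique_minimizer {E : Type u} [PseudoMetricSpace E] [MeasurableSpace E]
    [BorelSpace E] {Ω : Type w} {mΩ : MeasurableSpace Ω} {X : Set E} (hX : IsCompact X)
    {Φ : E → Ω → ℝ} (hcont : ∀ ω, ContinuousOn (fun x => Φ x ω) X)
    (hmeas : ∀ x ∈ X, Measurable (Φ x)) {z : Ω → E} (hz : ∀ ω, z ω ∈ X)
    (hmin : ∀ ω, ∀ x ∈ X, Φ x ω ≤ Φ (z ω) ω → x = z ω) : Measurable z := by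
  refine measurable_of_isClosed fun K hK => ?_
  have hXK := hX.inter_right hK
  obtain ⟨A, hAK, hAc, hAd⟩ := hXK.isSeparable.exists_countable_dense_subset
  obtain ⟨D, hDX, hDc, hDd⟩ := hX.isSeparable.exists_countable_dense_subset
  have hset : z ⁻¹' K = ⋂ k : ℕ, ⋃ q ∈ A, ⋂ p ∈ D, {ω | Φ q ω < Φ p ω + 1 / ((k : ℝ) + 1)} := by
    ext ω
    simp only [Set.mem_preimage, Set.mem_iInter, Set.mem_iUnion, Set.mem_ofPred_eq, exists_prop]
    exact mem_iff_exists_near_minimizer hXK (hcont ω) (hz ω) (hmin ω) hAK hAd hDX hDd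
  rw [hset]
  exact MeasurableSet.iInter fun k => MeasurableSet.biUnion hAc fun q hq =>
    MeasurableSet.biInter hDc fun p hp => measurableSet_lt (hmeas q (hAK hq).1)
      ((hmeas p (hDX hp)).add_const _)

variable {E : Type u} [NormedAddCommGroup E] [NormedSpace ℝ E] [SecondCountableTopology E]
  [MeasurableSpace E] [BorelSpace E] {X : Set E} {Ω : Type w} {mΩ : MeasurableSpace Ω}
  {ψ : E → ℝ} {v : Ω → E}

theorem measurable_fderivWithin_apply_sub (hX : Convex ℝ X) (hψ : DifferentiableOn ℝ ψ X)
    (hv : Measurable v) (hvX : ∀ ω, v ω ∈ X) {x : E} (hx : x ∈ X) :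
    Measurable fun ω => fderivWithin ℝ ψ X (v ω) (x - v ω) := by
  let s : ℕ → ℝ := fun k => 1 / ((k : ℝ) + 1)
  have hs : ∀ k, s k ∈ Set.Icc 0 1 := fun k =>
    ⟨by positivity, (div_le_one (by positivity)).2 (by simp)⟩
  have hmem : ∀ k ω, v ω + s k • (x - v ω) ∈ X := fun k ω =>
    hX.add_smul_sub_mem (hvX ω) hx (hs k)
  refine measurable_of_tendsto_metrizable
    (f := fun (k : ℕ) ω => ((k : ℝ) + 1) • (ψ (v ω + s k • (x - v ω)) - ψ (v ω)))
    (fun k => ?_) (tendsto_pi_nhds.2 fun ω => ?_)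
  · exact ((measurable_comp_of_continuousOn hψ.continuousOn (by fun_prop) (hmem k)).sub
      (measurable_comp_of_continuousOn hψ.continuousOn hv hvX)).const_smul
        ((k : ℝ) + 1)
  · refine (hψ (v ω) (hvX ω)).hasFDerivWithinAt.lim (d := fun k => s k • (x - v ω)) ?_
      (Eventually.of_forall fun k => hmem k ω) ?_
    · simpa [s] using (tendsto_one_div_add_atTop_nhds_zero_nat (𝕜 := ℝ)).smul_const (x - v ω)
    · refine tendsto_const_nhds.congr fun k => ?_
      rw [smul_smul, mul_one_div_cancel k.cast_add_one_ne_zero, one_smul]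

theorem measurable_bregman (hX : Convex ℝ X) (hψ : DifferentiableOn ℝ ψ X)
    (hv : Measurable v) (hvX : ∀ ω, v ω ∈ X) {x : E} (hx : x ∈ X) :
    Measurable fun ω => bregman X ψ x (v ω) :=
  (measurable_const.sub (measurable_comp_of_continuousOn hψ.continuousOn hv hvX)).sub
    (measurable_fderivWithin_apply_sub hX hψ hv hvX hx)

theorem stronglyMeasurable_clm_apply {y : Ω → E →L[ℝ] ℝ} (hy : StronglyMeasurable y)
    (hv : Measurable v) : StronglyMeasurable fun ω => y ω (v ω) :=
  isBoundedBilinearMap_apply.continuous.comp_stronglyMeasurable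
    (hy.prodMk hv.stronglyMeasurable)

theorem IsProx.measurable (hX : IsCompact X) (hψ : IsRegularizer X ψ) (hv : Measurable v)
    (hvX : ∀ ω, v ω ∈ X) {y : Ω → E →L[ℝ] ℝ} (hy : StronglyMeasurable y) {z : Ω → E}
    (hz : ∀ ω, IsProx X ψ (v ω) (y ω) (z ω)) : Measurable z := by
  have hψc := hψ.diff.continuousOn
  refine measurable_of_unique_minimizer hX (Φ := fun x ω => y ω (v ω - x) + bregman X ψ x (v ω))
    (fun ω => ?_) (fun x hx => ?_) (fun ω => (hz ω).1) (fun ω x hx hle => (hz ω).eq_of_le hψ hx hle)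
  · unfold bregman
    fun_prop
  · exact (stronglyMeasurable_clm_apply hy (hv.sub_const x)).measurable.add
      (measurable_bregman hψ.strong.1 hψ.diff hv hvX hx)

end MeasurableMinimizer

section StochasticMatrices

variable {ι : Type*} [Fintype ι]

theorem eq_univ_of_growing {S : ℕ → Finset ι} (hS : Monotone S) {B : ℕ}
    (hgrow : ∀ k, S (k + B) = S k → S k = Finset.univ) : S (Fintype.card ι * B) = Finset.univ := by
  have hcard : ∀ m ≤ Fintype.card ι, m ≤ (S (m * B)).card := by
    intro m
    induction m with
    | zero => simp
    | succ m ih =>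
      intro hm
      rw [Nat.succ_mul]
      by_cases hstable : S (m * B + B) = S (m * B)
      · simpa only [hstable, hgrow _ hstable, Finset.card_univ] using hm
      · have hlt := Finset.card_lt_card
          ((hS (Nat.le_add_right (m * B) B)).ssubset_of_ne (Ne.symm hstable))
        have := ih (by omega)
        omega
  exact Finset.eq_univ_of_card _ (le_antisymm (Finset.card_le_univ _) (hcard _ le_rfl))

variable [DecidableEq ι]

theorem sum_map_sum_smul_le_of_mem_doublyStochastic {E : Type u} [AddCommGroup E] [Module ℝ E]
    {X : Set E} {f : E → ℝ} (hf : ConvexOn ℝ X f) {W : Matrix ι ι ℝ}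
    (hW : W ∈ doublyStochastic ℝ ι) {x : ι → E} (hx : ∀ i, x i ∈ X) :
    ∑ i, f (∑ j, W i j • x j) ≤ ∑ j, f (x j) := by
  rw [mem_doublyStochastic_iff_sum] at hW
  calc ∑ i, f (∑ j, W i j • x j) ≤ ∑ i, ∑ j, W i j * f (x j) :=
        Finset.sum_le_sum fun i _ =>
          hf.map_sum_le (fun j _ => hW.1 i j) (hW.2.1 i) fun j _ => hx j
    _ = ∑ j, f (x j) := by
        rw [Finset.sum_comm]
        simp only [← Finset.sum_mul, hW.2.2, one_mul]

/-- The product `W (s + k - 1) ⋯ W s` of `k` consecutive weight matrices, which propagates the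
states at time `s` to time `s + k`. -/
def transition (W : ℕ → Matrix ι ι ℝ) (s : ℕ) : ℕ → Matrix ι ι ℝ
  | 0 => 1
  | k + 1 => W (s + k) * transition W s k

theorem transition_mem {S : Submonoid (Matrix ι ι ℝ)} {W : ℕ → Matrix ι ι ℝ}
    (hW : ∀ t, W t ∈ S) (s k : ℕ) : transition W s k ∈ S := by
  induction k with
  | zero => exact S.one_mem
  | succ k ih => exact S.mul_mem (hW _) ih

end StochasticMatrices

section Mixing

variable {n : ℕ} {edge : ℕ → Fin n → Fin n → Prop} {W : ℕ → Matrix (Fin n) (Fin n) ℝ} {η : ℝ}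
  {B : ℕ}

theorem IsMixing.weight_nonneg (h : IsMixing edge W η B) (hη : 0 ≤ η) (t : ℕ) (i j : Fin n) :
    0 ≤ W t i j := by
  by_cases he : edge t j i
  · exact hη.trans (h.weight_ge t i j he)
  · exact (h.weight_zero t i j he).ge

theorem IsMixing.mem_doublyStochastic (h : IsMixing edge W η B) (hη : 0 ≤ η) (t : ℕ) :
    W t ∈ doublyStochastic ℝ (Fin n) :=
  mem_doublyStochastic_iff_sum.2 ⟨h.weight_nonneg hη t, h.row_sum t, h.col_sum t⟩

theorem IsMixing.mem_rowStochastic (h : IsMixing edge W η B) (hη : 0 ≤ η) (t : ℕ) :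
    W t ∈ Matrix.rowStochastic ℝ (Fin n) :=
  Matrix.mem_rowStochastic_iff_sum.2 ⟨h.weight_nonneg hη t, h.row_sum t⟩

theorem IsMixing.pow_le_transition_succ (h : IsMixing edge W η B) (hη : 0 ≤ η) {s k : ℕ}
    {a i j : Fin n} (ha : η ^ k ≤ transition W s k a j) (he : edge (s + k) a i) :
    η ^ (k + 1) ≤ transition W s (k + 1) i j := by
  have hnonneg : ∀ b, 0 ≤ W (s + k) i b * transition W s k b j := fun b =>
    mul_nonneg (h.weight_nonneg hη _ _ _)
      (Matrix.nonneg_of_mem_rowStochastic (transition_mem (h.mem_rowStochastic hη) s k))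
  calc η ^ (k + 1) = η * η ^ k := pow_succ' η k
    _ ≤ W (s + k) i a * transition W s k a j :=
        mul_le_mul (h.weight_ge _ _ _ he) ha (by positivity) (h.weight_nonneg hη _ _ _)
    _ ≤ ∑ b, W (s + k) i b * transition W s k b j :=
        Finset.single_le_sum (fun b _ => hnonneg b) (Finset.mem_univ a)
    _ = transition W s (k + 1) i j := (Matrix.mul_apply ..).symm

theorem IsMixing.eq_univ_of_window_stable (h : IsMixing edge W η B) {s k : ℕ}
    {S : ℕ → Finset (Fin n)} (hS : Monotone S)
    (hstep : ∀ l a b, a ∈ S l → edge (s + l) a b → b ∈ S (l + 1)) (hne : (S k).Nonempty)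
    (hstable : S (k + B) = S k) : S k = Finset.univ := by
  obtain ⟨j, hj⟩ := hne
  refine Finset.eq_univ_iff_forall.2 fun b => ?_
  induction h.connected (s + k) j b with
  | refl => exact hj
  | @tail a b _ hab ha =>
    obtain ⟨t, hst, htB, he⟩ := hab
    obtain ⟨l, rfl⟩ := Nat.exists_eq_add_of_le hst
    have ha' : a ∈ S (k + l) := hS (Nat.le_add_right _ _) ha
    have hb : b ∈ S (k + l + 1) := hstep _ a b ha' (by rwa [← add_assoc])
    exact hstable ▸ hS (by omega : k + l + 1 ≤ k + B) hb

theorem IsMixing.pow_le_transition (h : IsMixing edge W η B) (hη : 0 ≤ η) (s : ℕ) (i j : Fin n) :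
    η ^ (n * B) ≤ transition W s (n * B) i j := by
  -- `S k` is the set of agents that `j` has reached through the edges of the first `k` graphs.
  let S : ℕ → Finset (Fin n) := fun k => {i | η ^ k ≤ transition W s k i j}
  have hmem : ∀ k i, i ∈ S k ↔ η ^ k ≤ transition W s k i j := fun k i => by simp [S]
  have hstep : ∀ k a b, a ∈ S k → edge (s + k) a b → b ∈ S (k + 1) := fun k a b ha he =>
    (hmem _ _).2 (h.pow_le_transition_succ hη ((hmem _ _).1 ha) he)
  have hmono : Monotone S := monotone_nat_of_le_succ fun k a ha => hstep k a a ha (h.self_loop _ _)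
  have hj : ∀ k, j ∈ S k := fun k => hmono k.zero_le ((hmem _ _).2 (by simp [transition]))
  have huniv : S (Fintype.card (Fin n) * B) = Finset.univ :=
    eq_univ_of_growing hmono fun k => h.eq_univ_of_window_stable hmono hstep ⟨j, hj k⟩
  rw [Fintype.card_fin] at huniv
  exact (hmem _ _).1 (huniv ▸ Finset.mem_univ i)

end Mixing

section Disagreement

variable {ι : Type*} {E : Type u} [NormedAddCommGroup E]

theorem diam_range_le {x : ι → E} {c : ℝ} (hc : 0 ≤ c) (h : ∀ i j, ‖x i - x j‖ ≤ c) :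
    Metric.diam (Set.range x) ≤ c :=
  Metric.diam_le_of_forall_dist_le hc <| by
    rintro _ ⟨i, rfl⟩ _ ⟨j, rfl⟩
    rw [dist_eq_norm]
    exact h i j

theorem norm_sub_le_diam_range [Finite ι] (x : ι → E) (i j : ι) :
    ‖x i - x j‖ ≤ Metric.diam (Set.range x) := by
  rw [← dist_eq_norm]
  exact Metric.dist_le_diam_of_mem (Set.finite_range x).isBounded ⟨i, rfl⟩ ⟨j, rfl⟩

theorem continuous_diam_range [Finite ι] :
    Continuous fun x : ι → E => Metric.diam (Set.range x) := by
  cases nonempty_fintype ι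
  refine (LipschitzWith.of_le_add_mul 2 fun x y => ?_).continuous
  refine diam_range_le (add_nonneg Metric.diam_nonneg (by positivity)) fun i j => ?_
  have hi := dist_le_pi_dist x y i
  have hj := dist_le_pi_dist x y j
  have hij := norm_sub_le_diam_range y i j
  rw [← dist_eq_norm] at hij ⊢
  have := dist_triangle4 (x i) (y i) (y j) (x j)
  rw [dist_comm (y j)] at this
  simp only [NNReal.coe_ofNat]
  linarith

variable [Fintype ι] [NormedSpace ℝ E]

theorem norm_sum_smul_sub_sum_smul_le (x : ι → E) {a b : ι → ℝ} {r : ℝ} (ha : ∀ i, 0 ≤ a i)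
    (hb : ∀ i, 0 ≤ b i) (har : ∑ i, a i = r) (hbr : ∑ i, b i = r) :
    ‖∑ i, a i • x i - ∑ i, b i • x i‖ ≤ r * Metric.diam (Set.range x) := by
  have hr : 0 ≤ r := har ▸ Finset.sum_nonneg fun i _ => ha i
  rcases hr.eq_or_lt with rfl | hr
  · have ha0 := (Finset.sum_eq_zero_iff_of_nonneg fun i _ => ha i).1 har
    have hb0 := (Finset.sum_eq_zero_iff_of_nonneg fun i _ => hb i).1 hbr
    simp_all
  · have hmem : ∀ w : ι → ℝ, (∀ i, 0 ≤ w i) → ∑ i, w i = r →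
        r⁻¹ • ∑ i, w i • x i ∈ convexHull ℝ (Set.range x) := fun w hw hwr => by
      simpa only [Finset.centerMass, hwr] using Finset.univ.centerMass_mem_convexHull
        (fun i _ => hw i) (hwr ▸ hr) fun i _ => Set.mem_range_self (f := x) i
    have hdist := Metric.dist_le_diam_of_mem
      (isBounded_convexHull.2 (Set.finite_range x).isBounded) (hmem a ha har) (hmem b hb hbr)
    rwa [convexHull_diam, dist_eq_norm, ← smul_sub, norm_smul, norm_inv,
      Real.norm_of_nonneg hr.le, inv_mul_le_iff₀ hr] at hdist

variable [DecidableEq ι]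

theorem norm_sum_rowStochastic_smul_sub_le {A : Matrix ι ι ℝ} (hA : A ∈ Matrix.rowStochastic ℝ ι)
    {δ : ℝ} (hδ : 0 ≤ δ) (hδA : ∀ i j, δ ≤ A i j) (x : ι → E) (i j : ι) :
    ‖∑ k, A i k • x k - ∑ k, A j k • x k‖ ≤ (1 - δ) * Metric.diam (Set.range x) := by
  -- Both rows contain the mass `δ` at the entry `i`; only the remaining mass `1 - δ` can differ.
  have hnonneg : ∀ a k : ι, 0 ≤ A a k - if k = i then δ else 0 := fun a k => by
    split_ifs <;> linarith [hδA a k]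
  have hsum : ∀ a : ι, ∑ k, (A a k - if k = i then δ else 0) = 1 - δ := fun a => by
    simp [Finset.sum_sub_distrib, Matrix.sum_row_of_mem_rowStochastic hA]
  simpa [sub_smul, Finset.sum_sub_distrib] using
    norm_sum_smul_sub_sum_smul_le x (hnonneg i) (hnonneg j) (hsum i) (hsum j)

variable {W : ℕ → Matrix ι ι ℝ} {x : ℕ → ι → E} {e : ℕ → ℝ}

theorem sum_transition_succ_smul (s k : ℕ) (y : ι → E) (i : ι) :
    ∑ j, transition W s (k + 1) i j • y j =
      ∑ a, W (s + k) i a • ∑ j, transition W s k a j • y j := by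
  simp only [transition, Matrix.mul_apply, Finset.sum_smul, Finset.smul_sum, smul_smul]
  exact Finset.sum_comm

theorem norm_sub_transition_le (hW : ∀ t, W t ∈ Matrix.rowStochastic ℝ ι)
    (hx : ∀ t i, ‖x (t + 1) i - ∑ j, W t i j • x t j‖ ≤ e t) (s k : ℕ) (i : ι) :
    ‖x (s + k) i - ∑ j, transition W s k i j • x s j‖ ≤ ∑ l ∈ Finset.range k, e (s + l) := by
  induction k generalizing i with
  | zero => simp [transition, Matrix.one_apply]
  | succ k ih =>
    have hnonneg : ∀ a, 0 ≤ W (s + k) i a := fun a => Matrix.nonneg_of_mem_rowStochastic (hW _)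
    have hsplit : x (s + (k + 1)) i - ∑ j, transition W s (k + 1) i j • x s j =
        (∑ a, W (s + k) i a • (x (s + k) a - ∑ j, transition W s k a j • x s j)) +
          (x (s + k + 1) i - ∑ j, W (s + k) i j • x (s + k) j) := by
      rw [sum_transition_succ_smul, ← add_assoc]
      simp only [smul_sub, Finset.sum_sub_distrib]
      abel
    rw [hsplit, Finset.sum_range_succ]
    refine (norm_add_le _ _).trans (add_le_add ?_ (hx _ _))
    calc ‖∑ a, W (s + k) i a • (x (s + k) a - ∑ j, transition W s k a j • x s j)‖
        ≤ ∑ a, W (s + k) i a * ∑ l ∈ Finset.range k, e (s + l) :=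
          norm_sum_le_of_le _ fun a _ => by
            rw [norm_smul, Real.norm_of_nonneg (hnonneg a)]
            exact mul_le_mul_of_nonneg_left (ih a) (hnonneg a)
      _ = ∑ l ∈ Finset.range k, e (s + l) := by
          rw [← Finset.sum_mul, Matrix.sum_row_of_mem_rowStochastic (hW _), one_mul]

theorem diam_range_add_le (hW : ∀ t, W t ∈ Matrix.rowStochastic ℝ ι)
    (hx : ∀ t i, ‖x (t + 1) i - ∑ j, W t i j • x t j‖ ≤ e t) {δ : ℝ} (hδ : 0 ≤ δ) (s k : ℕ)
    (htransition : ∀ i j, δ ≤ transition W s k i j) [Nonempty ι] :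
    Metric.diam (Set.range (x (s + k))) ≤
      (1 - δ) * Metric.diam (Set.range (x s)) + 2 * ∑ l ∈ Finset.range k, e (s + l) := by
  have hpair : ∀ i j, ‖x (s + k) i - x (s + k) j‖ ≤
      (1 - δ) * Metric.diam (Set.range (x s)) + 2 * ∑ l ∈ Finset.range k, e (s + l) :=
    fun i j => by
    have hi := norm_sub_transition_le hW hx s k i
    have hj := norm_sub_transition_le hW hx s k j
    have hij := norm_sum_rowStochastic_smul_sub_le (transition_mem hW s k) hδ htransition (x s) i j
    rw [← dist_eq_norm] at hi hj hij ⊢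
    have := dist_triangle4 (x (s + k) i) (∑ a, transition W s k i a • x s a)
      (∑ a, transition W s k j a • x s a) (x (s + k) j)
    rw [dist_comm (∑ a, transition W s k j a • x s a)] at this
    linarith
  obtain ⟨i⟩ := ‹Nonempty ι›
  exact diam_range_le ((norm_nonneg _).trans (hpair i i)) hpair

end Disagreement

section Sequences

theorem mul_sum_le_of_window_contraction {d b : ℕ → ℝ} {δ : ℝ} {M : ℕ} (hd : ∀ t, 0 ≤ d t)
    (hcontr : ∀ s, d (s + M) ≤ (1 - δ) * d s + b s) (T : ℕ) :
    δ * ∑ t ∈ Finset.range T, d t ≤ ∑ t ∈ Finset.range M, d t + ∑ t ∈ Finset.range T, b t := by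
  have hextend : ∑ t ∈ Finset.range T, d t ≤ ∑ t ∈ Finset.range (M + T), d t :=
    Finset.sum_le_sum_of_subset_of_nonneg (Finset.range_mono (Nat.le_add_left _ _))
      fun t _ _ => hd t
  have hshift : ∑ t ∈ Finset.range T, d (M + t) ≤
      (1 - δ) * ∑ t ∈ Finset.range T, d t + ∑ t ∈ Finset.range T, b t := by
    rw [Finset.mul_sum, ← Finset.sum_add_distrib]
    exact Finset.sum_le_sum fun t _ => add_comm M t ▸ hcontr t
  rw [Finset.sum_range_add] at hextend
  linarith

theorem sum_sub_div_le {S α : ℕ → ℝ} {R : ℝ} (hα : Antitone α) (hpos : ∀ t, 0 < α t)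
    (hR : ∀ t, S t ≤ R) {T : ℕ} (hT : 1 ≤ T) :
    ∑ t ∈ Finset.Icc 1 T, (S t - S (t + 1)) / α t ≤ (R - S (T + 1)) / α T := by
  induction T, hT using Nat.le_induction with
  | base =>
    rw [Finset.Icc_self, Finset.sum_singleton]
    gcongr
    exacts [(hpos 1).le, hR 1]
  | succ T hT ih =>
    have hstep : (R - S (T + 1)) / α T ≤ (R - S (T + 1)) / α (T + 1) :=
      div_le_div_of_nonneg_left (sub_nonneg.2 (hR _)) (hpos _) (hα T.le_succ)
    calc ∑ t ∈ Finset.Icc 1 (T + 1), (S t - S (t + 1)) / α t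
        ≤ (R - S (T + 1)) / α (T + 1) + (S (T + 1) - S (T + 1 + 1)) / α (T + 1) := by
          rw [Finset.sum_Icc_succ_top (by omega)]
          exact add_le_add_left (ih.trans hstep) _
      _ = (R - S (T + 1 + 1)) / α (T + 1) := by ring

theorem one_div_sqrt_le_two_mul_sqrt_sub_sqrt (T : ℕ) :
    1 / √((T + 1 : ℕ) : ℝ) ≤ 2 * (√((T + 1 : ℕ) : ℝ) - √(T : ℝ)) := by
  have hpos : 0 < √((T + 1 : ℕ) : ℝ) := Real.sqrt_pos.2 (by positivity)
  have hsucc : √((T + 1 : ℕ) : ℝ) ^ 2 = T + 1 := by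
    rw [Real.sq_sqrt (by positivity), Nat.cast_add_one]
  have hself : √(T : ℝ) ^ 2 = T := Real.sq_sqrt T.cast_nonneg
  rw [div_le_iff₀ hpos]
  linarith [sq_nonneg (√((T + 1 : ℕ) : ℝ) - √(T : ℝ))]

theorem sum_range_le_add_two_mul_sqrt {α : ℕ → ℝ} (hα : ∀ t : ℕ, 1 ≤ t → α t ≤ 1 / √(t : ℝ))
    (T : ℕ) : ∑ t ∈ Finset.range (T + 1), α t ≤ α 0 + 2 * √(T : ℝ) := by
  induction T with
  | zero => simp
  | succ T ih =>
    rw [Finset.sum_range_succ]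
    linarith [hα (T + 1) (by omega), one_div_sqrt_le_two_mul_sqrt_sub_sqrt T]

end Sequences

section Integrability

variable {Ω : Type w} {m mΩ : MeasurableSpace Ω} {P : Measure Ω}

theorem integrable_comp_of_continuousOn [IsFiniteMeasure P] {E : Type u} [TopologicalSpace E]
    [MeasurableSpace E] [BorelSpace E] {X : Set E} (hX : IsCompact X) {f : E → ℝ}
    (hf : ContinuousOn f X) {v : Ω → E} (hv : Measurable v) (hvX : ∀ ω, v ω ∈ X) :
    Integrable (fun ω => f (v ω)) P := by
  obtain ⟨C, hC⟩ := hX.exists_bound_of_continuousOn hf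
  exact Integrable.of_bound (measurable_comp_of_continuousOn hf hv hvX).aestronglyMeasurable C
    (Eventually.of_forall fun ω => hC _ (hvX ω))

theorem integral_le_of_condExp_le_const [IsProbabilityMeasure P] (hm : m ≤ mΩ) {f : Ω → ℝ} {c : ℝ}
    (hf : P[f | m] ≤ᵐ[P] fun _ => c) : ∫ ω, f ω ∂P ≤ c := by
  rw [← integral_condExp hm]
  simpa using integral_mono_ae integrable_condExp (integrable_const c) hf

variable {E : Type u} [NormedAddCommGroup E] [SecondCountableTopology E] [MeasurableSpace E]
  [BorelSpace E]

theorem integrable_diam_range [IsFiniteMeasure P] {ι : Type*} [Finite ι] {X : Set E}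
    (hX : IsCompact X) {x : ι → Ω → E} (hx : ∀ i, Measurable (x i)) (hxX : ∀ i ω, x i ω ∈ X) :
    Integrable (fun ω => Metric.diam (Set.range fun i => x i ω)) P :=
  integrable_comp_of_continuousOn (isCompact_univ_pi fun _ : ι => hX)
    continuous_diam_range.continuousOn (measurable_pi_lambda _ hx) fun ω i _ => hxX i ω

variable [NormedSpace ℝ E]

theorem measurable_sum_smul {ι : Type*} [Fintype ι] (a : ι → ℝ) {x : ι → Ω → E}
    (hx : ∀ i, Measurable (x i)) : Measurable fun ω => ∑ i, a i • x i ω :=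
  Finset.measurable_fun_sum _ fun i _ => (hx i).const_smul (a i)

theorem integrable_clm_apply {y : Ω → E →L[ℝ] ℝ} (hy : Integrable y P) {v : Ω → E}
    (hv : Measurable v) {C : ℝ} (hvC : ∀ ω, ‖v ω‖ ≤ C) : Integrable (fun ω => y ω (v ω)) P := by
  have hmeas : AEStronglyMeasurable (fun ω => y ω (v ω)) P :=
    isBoundedBilinearMap_apply.continuous.comp_aestronglyMeasurable
      (hy.aestronglyMeasurable.prodMk hv.aestronglyMeasurable)
  refine (hy.norm.mul_const C).mono' hmeas (Eventually.of_forall fun ω => ?_)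
  exact ((y ω).le_opNorm _).trans (mul_le_mul_of_nonneg_left (hvC ω) (norm_nonneg _))

theorem integral_clm_apply_eq_of_condExp [IsFiniteMeasure P] (hm : m ≤ mΩ) {y y' : Ω → E →L[ℝ] ℝ}
    (hy : Integrable y P) (hyy' : P[y | m] =ᵐ[P] y') {v : Ω → E} (hv : Measurable[m] v) {C : ℝ}
    (hvC : ∀ ω, ‖v ω‖ ≤ C) : ∫ ω, y ω (v ω) ∂P = ∫ ω, y' ω (v ω) ∂P := by
  have hpull := condExp_bilin_of_stronglyMeasurable_right (μ := P)
    (ContinuousLinearMap.id ℝ (E →L[ℝ] ℝ)) hv.stronglyMeasurable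
    (integrable_clm_apply hy (hv.mono hm le_rfl) hvC) hy
  rw [← integral_condExp hm]
  refine integral_congr_ae (hpull.trans ?_)
  filter_upwards [hyy'] with ω hω
  simp [hω]

end Integrability

section Subgradients

variable {E : Type u} [NormedAddCommGroup E]

theorem sq_norm_le_of_norm_le {g y : E} {L : ℝ} (hg : ‖g‖ ≤ L) :
    ‖y‖ ^ 2 ≤ 2 * L ^ 2 + 2 * ‖g - y‖ ^ 2 := by
  have hy : ‖y‖ ≤ L + ‖g - y‖ := by
    have := norm_sub_le g (g - y)
    rw [sub_sub_cancel] at this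
    linarith
  nlinarith [norm_nonneg y, sq_nonneg (L - ‖g - y‖)]

variable [NormedSpace ℝ E]

theorem IsSubgradient.norm_le_of_lipschitz {O : Set E} {h : E → ℝ} {p : E} {g : E →L[ℝ] ℝ}
    (hg : IsSubgradient O h p g) (hO : O ∈ 𝓝 p) {C : ℝ} (hC : 0 ≤ C)
    (hlip : ∀ y ∈ O, h y - h p ≤ C * ‖y - p‖) : ‖g‖ ≤ C := by
  have hmem : ∀ᶠ w in 𝓝 (0 : E), p + w ∈ O :=
    (continuous_const_add p).continuousAt.preimage_mem_nhds (by simpa using hO)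
  have hneg : ∀ᶠ w in 𝓝 (0 : E), p + -w ∈ O :=
    (continuous_neg.tendsto' (0 : E) 0 neg_zero).eventually hmem
  have hle : ∀ w, p + w ∈ O → g w ≤ C * ‖w‖ := fun w hw => by
    have hsub := hg _ hw
    have hup := hlip _ hw
    rw [add_sub_cancel_left] at hsub hup
    linarith
  refine ContinuousLinearMap.opNorm_le_of_nhds_zero hC ?_
  filter_upwards [hmem, hneg] with w hw hw'
  rw [Real.norm_eq_abs, abs_le']
  exact ⟨hle w hw, by simpa using hle (-w) hw'⟩

end Subgradients

section NetworkRun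

variable {Ω : Type w} [MeasurableSpace Ω]
  {E : Type u} [NormedAddCommGroup E] [NormedSpace ℝ E] [MeasurableSpace E]
  {F : Type v} [NormedAddCommGroup F] [NormedSpace ℝ F] {n m d : ℕ}
  {N : Network E F n m d} {p : Iterates Ω E n d} {q : Iterates Ω F m d} {P : Measure Ω}
  {ξ : Ω → (Fin d → ℝ)} {α : ℕ → ℝ} {ℱ : ℕ → MeasurableSpace Ω} {Y : Set F} {η L ν Λ : ℝ} {B : ℕ}

theorem IsRun.x_mem (hr : IsRun N p q P ξ α ℱ) (t : ℕ) (i : Fin n) (ω : Ω) : p.x t i ω ∈ N.X := by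
  cases t with
  | zero => exact hr.init_mem i ω
  | succ t => exact (hr.update t i ω).1

theorem IsRun.v_mem (hr : IsRun N p q P ξ α ℱ) (ha : N.IsAdmissible Y P ξ η B L) (hη : 0 ≤ η)
    (t : ℕ) (i : Fin n) (ω : Ω) : N.v p t i ω ∈ N.X :=
  ha.X_convex.sum_mem (fun j _ => ha.mixing.weight_nonneg hη t i j) (ha.mixing.row_sum t i)
    fun j _ => hr.x_mem t j ω

theorem IsRun.measurable_x [SecondCountableTopology E] [BorelSpace E] (hr : IsRun N p q P ξ α ℱ)
    (ha : N.IsAdmissible Y P ξ η B L) (hη : 0 ≤ η) (hmono : Monotone ℱ)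
    (h0 : ∀ i, Measurable[ℱ 0] (p.x 0 i)) (t : ℕ) (i : Fin n) : Measurable[ℱ t] (p.x t i) := by
  induction t generalizing i with
  | zero => exact h0 i
  | succ t ih =>
    have hv : Measurable[ℱ (t + 1)] (N.v p t i) :=
      (measurable_sum_smul (N.W t i) ih).mono (hmono t.le_succ) le_rfl
    exact IsProx.measurable ha.X_compact ha.regularizer hv (hr.v_mem ha hη t i)
      ((hr.gHat_meas t i).const_smul (α t)).neg (hr.update t i)

variable [MeasurableSpace F]

/-- A run of one network against an arbitrary opponent whose strategies `q` are adapted and lie in a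
compact convex set `Y`. The regret analysis sees the opponent only through this interface, so the
two networks of a game share it. -/
structure IsNetworkRun (N : Network E F n m d) (p : Iterates Ω E n d) (q : Iterates Ω F m d)
    (P : Measure Ω) (ξ : Ω → (Fin d → ℝ)) (α : ℕ → ℝ) (ℱ : ℕ → MeasurableSpace Ω) (Y : Set F)
    (η : ℝ) (B : ℕ) (L ν : ℝ) : Prop where
  η_nonneg : 0 ≤ η
  L_nonneg : 0 ≤ L
  adm : N.IsAdmissible Y P ξ η B L
  run : IsRun N p q P ξ α ℱ
  unbiased : IsUnbiased N p q P ξ ν ℱ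
  info_le : ∀ t, ℱ t ≤ ‹MeasurableSpace Ω›
  x_adapted : ∀ t i, Measurable[ℱ t] (p.x t i)
  opp_compact : IsCompact Y
  opp_convex : Convex ℝ Y
  opp_mem : ∀ t j ω, q.x t j ω ∈ Y
  opp_adapted : ∀ t j, Measurable[ℱ t] (q.x t j)

theorem IsNetworkRun.v_mem (h : IsNetworkRun N p q P ξ α ℱ Y η B L ν) (t : ℕ) (i : Fin n) (ω : Ω) :
    N.v p t i ω ∈ N.X :=
  h.run.v_mem h.adm h.η_nonneg t i ω

theorem IsNetworkRun.u_mem (h : IsNetworkRun N p q P ξ α ℱ Y η B L ν) (t : ℕ) (i : Fin n) (ω : Ω) :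
    N.u q t i ω ∈ Y :=
  h.opp_convex.sum_mem (fun j _ => h.adm.cross.nonneg t i j) (h.adm.cross.row_sum t i)
    fun j _ => h.opp_mem t j ω

theorem IsNetworkRun.measurable_x (h : IsNetworkRun N p q P ξ α ℱ Y η B L ν) (t : ℕ) (i : Fin n) :
    Measurable (p.x t i) :=
  (h.x_adapted t i).mono (h.info_le t) le_rfl

theorem IsNetworkRun.measurable_opp (h : IsNetworkRun N p q P ξ α ℱ Y η B L ν) (t : ℕ)
    (j : Fin m) : Measurable (q.x t j) :=
  (h.opp_adapted t j).mono (h.info_le t) le_rfl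

theorem IsNetworkRun.ae_norm_g_le (h : IsNetworkRun N p q P ξ α ℱ Y η B L ν) (t : ℕ) (i : Fin n) :
    ∀ᵐ ω ∂P, ‖p.g t i ω‖ ≤ L := by
  filter_upwards [h.unbiased.g_sub t i] with ω hω
  have hv := h.adm.X_subset (h.v_mem t i ω)
  refine hω.norm_le_of_lipschitz (h.adm.O_open.mem_nhds hv) h.L_nonneg fun y hy => ?_
  simpa using (abs_le.1 (h.adm.lipschitz i y hy _ hv _ (h.u_mem t i ω) _ (h.u_mem t i ω))).2

theorem IsNetworkRun.ae_sq_norm_gHat_le (h : IsNetworkRun N p q P ξ α ℱ Y η B L ν) (t : ℕ)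
    (i : Fin n) :
    ∀ᵐ ω ∂P, ‖p.gHat t i ω‖ ^ 2 ≤ 2 * L ^ 2 + 2 * ‖p.g t i ω - p.gHat t i ω‖ ^ 2 := by
  filter_upwards [h.ae_norm_g_le t i] with ω hω
  exact sq_norm_le_of_norm_le hω

theorem IsNetworkRun.integrable_sq_norm_gHat [IsFiniteMeasure P]
    (h : IsNetworkRun N p q P ξ α ℱ Y η B L ν) (t : ℕ) (i : Fin n) :
    Integrable (fun ω => ‖p.gHat t i ω‖ ^ 2) P := by
  refine ((integrable_const (2 * L ^ 2)).add ((h.unbiased.sq_int t i).const_mul 2)).mono'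
    ((h.unbiased.gHat_int t i).aestronglyMeasurable.norm.pow 2) ?_
  filter_upwards [h.ae_sq_norm_gHat_le t i] with ω hω
  rwa [Real.norm_of_nonneg (by positivity)]

variable [IsProbabilityMeasure P]

theorem IsNetworkRun.integral_sq_norm_gHat_le (h : IsNetworkRun N p q P ξ α ℱ Y η B L ν) (t : ℕ)
    (i : Fin n) : ∫ ω, ‖p.gHat t i ω‖ ^ 2 ∂P ≤ 2 * (L ^ 2 + ν ^ 2) := by
  have hvar := integral_le_of_condExp_le_const (h.info_le t) (h.unbiased.variance t i)
  have hsq := (h.unbiased.sq_int t i).const_mul 2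
  calc ∫ ω, ‖p.gHat t i ω‖ ^ 2 ∂P
      ≤ ∫ ω, (2 * L ^ 2 + 2 * ‖p.g t i ω - p.gHat t i ω‖ ^ 2) ∂P :=
        integral_mono_ae (h.integrable_sq_norm_gHat t i) ((integrable_const _).add hsq)
          (h.ae_sq_norm_gHat_le t i)
    _ = 2 * L ^ 2 + 2 * ∫ ω, ‖p.g t i ω - p.gHat t i ω‖ ^ 2 ∂P := by
        rw [integral_add (integrable_const _) hsq, integral_const, probReal_univ, one_smul,
          integral_const_mul]
    _ ≤ 2 * (L ^ 2 + ν ^ 2) := by linarith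

theorem IsNetworkRun.integral_norm_gHat_le (h : IsNetworkRun N p q P ξ α ℱ Y η B L ν) (t : ℕ)
    (i : Fin n) : ∫ ω, ‖p.gHat t i ω‖ ∂P ≤ 1 + L ^ 2 + ν ^ 2 := by
  have hsq := (h.integrable_sq_norm_gHat t i).const_mul (1 / 2)
  calc ∫ ω, ‖p.gHat t i ω‖ ∂P
      ≤ ∫ ω, (1 + 1 / 2 * ‖p.gHat t i ω‖ ^ 2) ∂P :=
        integral_mono (h.unbiased.gHat_int t i).norm ((integrable_const _).add hsq)
          fun ω => by nlinarith [sq_nonneg (‖p.gHat t i ω‖ - 1)]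
    _ = 1 + 1 / 2 * ∫ ω, ‖p.gHat t i ω‖ ^ 2 ∂P := by
        rw [integral_add (integrable_const _) hsq, integral_const, probReal_univ, one_smul,
          integral_const_mul]
    _ ≤ 1 + L ^ 2 + ν ^ 2 := by linarith [h.integral_sq_norm_gHat_le t i]

end NetworkRun

section ExpectedDisagreement

variable {Ω : Type w} {E : Type u} [NormedAddCommGroup E] [NormedSpace ℝ E] {n m d : ℕ}

/-- The disagreement of the agents of one network at time `t`: the diameter of the set of their
strategies. -/
noncomputable def Iterates.disagreement (p : Iterates Ω E n d) (t : ℕ) (ω : Ω) : ℝ :=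
  Metric.diam (Set.range fun i => p.x t i ω)

/-- A bound on the expectation of the sum over all `n` agents of the norms of their sampled
subgradients, which limits how far one mirror step moves the network; it comes from
`‖y‖ ≤ 1 + ‖y‖ ^ 2 / 2`. -/
def subgradientBound (n : ℕ) (L ν : ℝ) : ℝ := n * (1 + L ^ 2 + ν ^ 2)

theorem subgradientBound_nonneg (n : ℕ) (L ν : ℝ) : 0 ≤ subgradientBound n L ν := by
  unfold subgradientBound
  positivity

theorem mul_sum_le_of_drift {a α : ℕ → ℝ} {M : ℕ} {δ K Λ : ℝ} (ha : ∀ t, 0 ≤ a t)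
    (hα : ∀ t, 0 ≤ α t) (hK : 0 ≤ K)
    (hcontr : ∀ s, a (s + M) ≤ (1 - δ) * a s + 2 * (M * (K * α s)))
    (hgrowth : ∀ t : ℕ, a t ≤ 2 * Λ + 2 * (t * (K * α 0))) (T : ℕ) :
    δ * ∑ t ∈ Finset.range (T + 1), a t ≤
      2 * M * (Λ + (M + 1) * (K * ∑ t ∈ Finset.range (T + 1), α t)) := by
  set S := ∑ t ∈ Finset.range (T + 1), α t
  have hα_le : α 0 ≤ S :=
    Finset.single_le_sum (fun t _ => hα t) (Finset.mem_range.2 T.succ_pos)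
  have hfirst : ∀ t ∈ Finset.range M, a t ≤ 2 * Λ + 2 * (M * (K * S)) := fun t ht => by
    refine (hgrowth t).trans ?_
    have htM : (t : ℝ) ≤ M := Nat.cast_le.2 (Finset.mem_range.1 ht).le
    gcongr
    exact mul_nonneg hK (hα 0)
  calc δ * ∑ t ∈ Finset.range (T + 1), a t
      ≤ ∑ t ∈ Finset.range M, a t + ∑ t ∈ Finset.range (T + 1), 2 * (M * (K * α t)) :=
        mul_sum_le_of_window_contraction ha hcontr (T + 1)
    _ ≤ M * (2 * Λ + 2 * (M * (K * S))) + 2 * (M * (K * S)) := by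
        simp only [← Finset.mul_sum]
        refine add_le_add_left ?_ _
        simpa only [Finset.card_range, nsmul_eq_mul] using
          Finset.sum_le_card_nsmul _ _ _ hfirst
    _ = 2 * M * (Λ + (M + 1) * (K * S)) := by ring

variable [MeasurableSpace Ω] [MeasurableSpace E]
  {F : Type v} [NormedAddCommGroup F] [NormedSpace ℝ F] [MeasurableSpace F]
  {N : Network E F n m d} {p : Iterates Ω E n d} {q : Iterates Ω F m d} {P : Measure Ω}
  {ξ : Ω → (Fin d → ℝ)} {α : ℕ → ℝ} {ℱ : ℕ → MeasurableSpace Ω} {Y : Set F} {η L ν Λ : ℝ} {B : ℕ}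

theorem IsNetworkRun.norm_x_succ_sub_v_le (h : IsNetworkRun N p q P ξ α ℱ Y η B L ν) {t : ℕ}
    (hα : 0 ≤ α t) (i : Fin n) (ω : Ω) :
    ‖p.x (t + 1) i ω - N.v p t i ω‖ ≤ α t * ∑ j, ‖p.gHat t j ω‖ := by
  have hstep := (h.run.update t i ω).norm_sub_le h.adm.regularizer (h.v_mem t i ω)
  rw [norm_neg, norm_smul, Real.norm_of_nonneg hα] at hstep
  refine hstep.trans (mul_le_mul_of_nonneg_left ?_ hα)
  exact Finset.single_le_sum (f := fun j => ‖p.gHat t j ω‖) (fun j _ => norm_nonneg _)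
    (Finset.mem_univ i)

theorem IsNetworkRun.disagreement_add_le [Nonempty (Fin n)]
    (h : IsNetworkRun N p q P ξ α ℱ Y η B L ν) (hα : ∀ t, 0 ≤ α t) {δ : ℝ} (hδ : 0 ≤ δ) (s k : ℕ)
    (htransition : ∀ i j, δ ≤ transition N.W s k i j) (ω : Ω) :
    p.disagreement (s + k) ω ≤ (1 - δ) * p.disagreement s ω +
      2 * ∑ l ∈ Finset.range k, α (s + l) * ∑ j, ‖p.gHat (s + l) j ω‖ :=
  diam_range_add_le (x := fun t i => p.x t i ω) (e := fun t => α t * ∑ j, ‖p.gHat t j ω‖)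
    (h.adm.mixing.mem_rowStochastic h.η_nonneg) (fun t i => h.norm_x_succ_sub_v_le (hα t) i ω)
    hδ s k htransition

theorem IsNetworkRun.integrable_sum_norm_gHat (h : IsNetworkRun N p q P ξ α ℱ Y η B L ν) (t : ℕ) :
    Integrable (fun ω => ∑ j, ‖p.gHat t j ω‖) P :=
  integrable_finsetSum _ fun j _ => (h.unbiased.gHat_int t j).norm

variable [IsProbabilityMeasure P]

theorem IsNetworkRun.integral_sum_norm_gHat_le (h : IsNetworkRun N p q P ξ α ℱ Y η B L ν) (t : ℕ) :
    ∫ ω, ∑ j, ‖p.gHat t j ω‖ ∂P ≤ subgradientBound n L ν := by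
  rw [integral_finsetSum _ fun j _ => (h.unbiased.gHat_int t j).norm]
  refine (Finset.sum_le_card_nsmul _ _ _ fun j _ => h.integral_norm_gHat_le t j).trans_eq ?_
  rw [Finset.card_univ, Fintype.card_fin, nsmul_eq_mul, subgradientBound]

variable [SecondCountableTopology E] [BorelSpace E]

theorem IsNetworkRun.integrable_disagreement (h : IsNetworkRun N p q P ξ α ℱ Y η B L ν) (t : ℕ) :
    Integrable (p.disagreement t) P :=
  integrable_diam_range h.adm.X_compact (h.measurable_x t) (h.run.x_mem t)

theorem IsNetworkRun.integral_disagreement_add_le [Nonempty (Fin n)]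
    (h : IsNetworkRun N p q P ξ α ℱ Y η B L ν) (hα : Antitone α) (hα0 : ∀ t, 0 ≤ α t) {δ : ℝ}
    (hδ : 0 ≤ δ) (s k : ℕ) (htransition : ∀ i j, δ ≤ transition N.W s k i j) :
    ∫ ω, p.disagreement (s + k) ω ∂P ≤ (1 - δ) * ∫ ω, p.disagreement s ω ∂P +
      2 * (k * (subgradientBound n L ν * α s)) := by
  have hstep : ∀ l, Integrable (fun ω => α (s + l) * ∑ j, ‖p.gHat (s + l) j ω‖) P := fun l =>
    (h.integrable_sum_norm_gHat (s + l)).const_mul _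
  have hsteps : Integrable
      (fun ω => ∑ l ∈ Finset.range k, α (s + l) * ∑ j, ‖p.gHat (s + l) j ω‖) P :=
    integrable_finsetSum _ fun l _ => hstep l
  have hstep_le : ∀ l ∈ Finset.range k, ∫ ω, α (s + l) * ∑ j, ‖p.gHat (s + l) j ω‖ ∂P ≤
      subgradientBound n L ν * α s := fun l _ => by
    rw [integral_const_mul, mul_comm]
    exact mul_le_mul (h.integral_sum_norm_gHat_le _) (hα (Nat.le_add_right _ _)) (hα0 _)
      (subgradientBound_nonneg n L ν)
  calc ∫ ω, p.disagreement (s + k) ω ∂P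
      ≤ ∫ ω, ((1 - δ) * p.disagreement s ω +
          2 * ∑ l ∈ Finset.range k, α (s + l) * ∑ j, ‖p.gHat (s + l) j ω‖) ∂P :=
        integral_mono (h.integrable_disagreement _)
          (((h.integrable_disagreement s).const_mul _).add (hsteps.const_mul 2))
          (h.disagreement_add_le hα0 hδ s k htransition)
    _ = (1 - δ) * ∫ ω, p.disagreement s ω ∂P +
          2 * ∑ l ∈ Finset.range k, ∫ ω, α (s + l) * ∑ j, ‖p.gHat (s + l) j ω‖ ∂P := by
        rw [integral_add ((h.integrable_disagreement s).const_mul _) (hsteps.const_mul 2),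
          integral_const_mul, integral_const_mul, integral_finsetSum _ fun l _ => hstep l]
    _ ≤ (1 - δ) * ∫ ω, p.disagreement s ω ∂P + 2 * (k * (subgradientBound n L ν * α s)) := by
        gcongr
        simpa using Finset.sum_le_card_nsmul _ _ _ hstep_le

theorem IsNetworkRun.integral_disagreement_zero_le [Nonempty (Fin n)]
    (h : IsNetworkRun N p q P ξ α ℱ Y η B L ν) (hinit : ∀ i ω, ‖p.x 0 i ω‖ ≤ Λ) :
    ∫ ω, p.disagreement 0 ω ∂P ≤ 2 * Λ := by
  have hpair : ∀ ω i j, ‖p.x 0 i ω - p.x 0 j ω‖ ≤ 2 * Λ := fun ω i j => by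
    linarith [norm_sub_le (p.x 0 i ω) (p.x 0 j ω), hinit i ω, hinit j ω]
  obtain ⟨i⟩ := ‹Nonempty (Fin n)›
  have hle : ∀ ω, p.disagreement 0 ω ≤ 2 * Λ := fun ω =>
    diam_range_le ((norm_nonneg _).trans (hpair ω i i)) (hpair ω)
  simpa using integral_mono (h.integrable_disagreement 0) (integrable_const (2 * Λ)) hle

/-- A bound on the expected disagreement of one network, accumulated over a period in which the step
sizes add up to `S`. The graphs need `n * B` steps to connect all agents. -/
noncomputable def disagreementBound (n B : ℕ) (η L ν Λ S : ℝ) : ℝ :=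
  2 * (n * B : ℕ) * (Λ + ((n * B : ℕ) + 1) * (subgradientBound n L ν * S)) / η ^ (n * B)

theorem IsNetworkRun.sum_integral_disagreement_le [Nonempty (Fin n)]
    (h : IsNetworkRun N p q P ξ α ℱ Y η B L ν) (hη : 0 < η) (hα : Antitone α) (hα0 : ∀ t, 0 ≤ α t)
    (hinit : ∀ i ω, ‖p.x 0 i ω‖ ≤ Λ) (T : ℕ) :
    ∑ t ∈ Finset.range (T + 1), ∫ ω, p.disagreement t ω ∂P ≤
      disagreementBound n B η L ν Λ (∑ t ∈ Finset.range (T + 1), α t) := by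
  rw [disagreementBound, le_div_iff₀ (pow_pos hη _), mul_comm]
  refine mul_sum_le_of_drift (a := fun t => ∫ ω, p.disagreement t ω ∂P) (M := n * B)
    (fun t => integral_nonneg fun ω => Metric.diam_nonneg) hα0
    (subgradientBound_nonneg n L ν) (fun s => h.integral_disagreement_add_le hα hα0
      (pow_nonneg h.η_nonneg _) s _ (h.adm.mixing.pow_le_transition h.η_nonneg s))
    (fun t => ?_) T
  have hgrowth := h.integral_disagreement_add_le hα hα0 le_rfl 0 t fun i j =>
    Matrix.nonneg_of_mem_rowStochastic
      (transition_mem (h.adm.mixing.mem_rowStochastic h.η_nonneg) 0 t)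
  rw [zero_add, sub_zero, one_mul] at hgrowth
  exact hgrowth.trans (by gcongr; exact h.integral_disagreement_zero_le hinit)

end ExpectedDisagreement

section Regret

variable {Ω : Type w} [MeasurableSpace Ω] {E : Type u} [NormedAddCommGroup E] [NormedSpace ℝ E]
  {F : Type v} [NormedAddCommGroup F] [NormedSpace ℝ F] {n m d : ℕ} {N : Network E F n m d}
  {p : Iterates Ω E n d} {q : Iterates Ω F m d} {P : Measure Ω} {ξ : Ω → (Fin d → ℝ)} {α : ℕ → ℝ}
  {ℱ : ℕ → MeasurableSpace Ω} {Y : Set F} {η L ν R : ℝ} {B : ℕ}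

theorem Network.IsAdmissible.continuousOn_avgCost (ha : N.IsAdmissible Y P ξ η B L) (hL : 0 ≤ L) :
    ContinuousOn (fun z : E × F => N.avgCost P ξ z.1 z.2) (N.X ×ˢ Y) := by
  refine continuousOn_const.mul (continuousOn_finsetSum _ fun i _ => ?_)
  refine (LipschitzOnWith.of_dist_le_mul (K := (2 * L).toNNReal)
    fun z hz z' hz' => ?_).continuousOn
  rw [Real.dist_eq, Real.coe_toNNReal _ (by positivity), dist_eq_norm]
  refine (ha.lipschitz i _ (ha.X_subset hz.1) _ (ha.X_subset hz'.1) _ hz.2 _ hz'.2).trans ?_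
  have hnorm := add_le_add (norm_fst_le (z - z')) (norm_snd_le (z - z'))
  exact (mul_le_mul_of_nonneg_left hnorm hL).trans_eq (by ring)

/-- The regret of a whole network at time `t` against the strategy `z`, with the costs replaced by
their linearizations at the sampled subgradients. -/
def Network.linearizedRegret (N : Network E F n m d) (p : Iterates Ω E n d) (z : E) (t : ℕ)
    (ω : Ω) : ℝ :=
  ∑ j, p.gHat t j ω (N.v p t j ω - z)

variable [MeasurableSpace E] [MeasurableSpace F]

theorem IsNetworkRun.mul_linearizedRegret_le (h : IsNetworkRun N p q P ξ α ℱ Y η B L ν) {z : E}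
    (hz : z ∈ N.X) (t : ℕ) (ω : Ω) :
    α t * N.linearizedRegret p z t ω ≤
      ∑ j, bregman N.X N.reg z (p.x t j ω) - ∑ j, bregman N.X N.reg z (p.x (t + 1) j ω) +
        α t ^ 2 * (1 / 2 * ∑ j, ‖p.gHat t j ω‖ ^ 2) := by
  have hagent : ∀ j, α t * p.gHat t j ω (N.v p t j ω - z) ≤
      bregman N.X N.reg z (N.v p t j ω) - bregman N.X N.reg z (p.x (t + 1) j ω) +
        α t ^ 2 * (1 / 2 * ‖p.gHat t j ω‖ ^ 2) := fun j => by
    have hstep := (h.run.update t j ω).linear_regret_le h.adm.regularizer (h.v_mem t j ω) hz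
    rw [norm_smul, mul_pow, Real.norm_eq_abs, sq_abs, smul_apply, smul_eq_mul] at hstep
    linarith
  have hmix : ∑ j, bregman N.X N.reg z (N.v p t j ω) ≤ ∑ j, bregman N.X N.reg z (p.x t j ω) :=
    sum_map_sum_smul_le_of_mem_doublyStochastic (h.adm.regularizer.convex_right z hz)
      (h.adm.mixing.mem_doublyStochastic h.η_nonneg t) fun j => h.run.x_mem t j ω
  have hsum := Finset.sum_le_sum fun j (_ : j ∈ Finset.univ) => hagent j
  simp only [Finset.sum_add_distrib, Finset.sum_sub_distrib, ← Finset.mul_sum] at hsum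
  rw [Network.linearizedRegret]
  linarith

theorem IsNetworkRun.sum_linearizedRegret_le (h : IsNetworkRun N p q P ξ α ℱ Y η B L ν)
    (hdiam : ∀ x ∈ N.X, ∀ x' ∈ N.X, bregman N.X N.reg x x' ≤ R) (hα : Antitone α)
    (hpos : ∀ t, 0 < α t) {z : E} (hz : z ∈ N.X) {T : ℕ} (hT : 1 ≤ T) (ω : Ω) :
    ∑ t ∈ Finset.Icc 1 T, N.linearizedRegret p z t ω ≤
      n * R / α T + ∑ t ∈ Finset.Icc 1 T, α t * (1 / 2 * ∑ j, ‖p.gHat t j ω‖ ^ 2) := by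
  set Φ : ℕ → ℝ := fun t => ∑ j, bregman N.X N.reg z (p.x t j ω)
  have hΦ_nonneg : 0 ≤ Φ (T + 1) :=
    Finset.sum_nonneg fun j _ => h.adm.regularizer.bregman_nonneg (h.run.x_mem _ j ω) hz
  have hΦ_le : ∀ t, Φ t ≤ n * R := fun t => by
    simpa using Finset.sum_le_card_nsmul Finset.univ _ R fun j _ =>
      hdiam z hz _ (h.run.x_mem t j ω)
  have hstep : ∀ t, N.linearizedRegret p z t ω ≤
      (Φ t - Φ (t + 1)) / α t + α t * (1 / 2 * ∑ j, ‖p.gHat t j ω‖ ^ 2) := fun t => by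
    have ht := hpos t
    have hmul : α t * N.linearizedRegret p z t ω ≤
        Φ t - Φ (t + 1) + α t ^ 2 * (1 / 2 * ∑ j, ‖p.gHat t j ω‖ ^ 2) :=
      h.mul_linearizedRegret_le hz t ω
    rw [← mul_le_mul_iff_right₀ ht]
    refine hmul.trans_eq ?_
    field_simp
  refine (Finset.sum_le_sum fun t _ => hstep t).trans ?_
  rw [Finset.sum_add_distrib]
  gcongr
  refine (sum_sub_div_le hα hpos hΦ_le hT).trans ?_
  exact div_le_div_of_nonneg_right (by linarith) (hpos T).le

theorem IsNetworkRun.norm_x_sub_v_le (h : IsNetworkRun N p q P ξ α ℱ Y η B L ν) (t : ℕ)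
    (i j : Fin n) (ω : Ω) : ‖p.x t i ω - N.v p t j ω‖ ≤ p.disagreement t ω := by
  have := norm_sum_smul_sub_sum_smul_le (fun j => p.x t j ω) (a := Pi.single i 1) (b := N.W t j)
    (r := 1) (fun k => by by_cases hk : k = i <;> simp [hk])
    (h.adm.mixing.weight_nonneg h.η_nonneg t j) (by simp) (h.adm.mixing.row_sum t j)
  simpa [Pi.single_apply, Network.v, Iterates.disagreement] using this

theorem IsNetworkRun.norm_u_sub_u_le (h : IsNetworkRun N p q P ξ α ℱ Y η B L ν) (t : ℕ)
    (i j : Fin n) (ω : Ω) : ‖N.u q t i ω - N.u q t j ω‖ ≤ q.disagreement t ω := by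
  simpa [Network.u, Iterates.disagreement] using
    norm_sum_smul_sub_sum_smul_le (fun k => q.x t k ω) (h.adm.cross.nonneg t i)
      (h.adm.cross.nonneg t j) (h.adm.cross.row_sum t i) (h.adm.cross.row_sum t j)

theorem IsNetworkRun.cost_sub_cost_le (h : IsNetworkRun N p q P ξ α ℱ Y η B L ν) {z : E}
    (hz : z ∈ N.X) {t : ℕ} (i j : Fin n) {ω : Ω}
    (hg : IsSubgradient N.O
      (fun x => N.cost P ξ j x (N.u q t j ω)) (N.v p t j ω) (p.g t j ω)) :
    N.cost P ξ j (p.x t i ω) (N.u q t i ω) - N.cost P ξ j z (N.u q t i ω) ≤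
      p.g t j ω (N.v p t j ω - z) + L * (p.disagreement t ω + 2 * q.disagreement t ω) := by
  have hzO := h.adm.X_subset hz
  have hxO := h.adm.X_subset (h.run.x_mem t i ω)
  have hvO := h.adm.X_subset (h.v_mem t j ω)
  have hx := (abs_le.1 (h.adm.lipschitz j _ hxO _ hvO _ (h.u_mem t i ω) _ (h.u_mem t j ω))).2
  have hz' := (abs_le.1 (h.adm.lipschitz j _ hzO _ hzO _ (h.u_mem t j ω) _ (h.u_mem t i ω))).2
  have hlinear : N.cost P ξ j (N.v p t j ω) (N.u q t j ω) - N.cost P ξ j z (N.u q t j ω) ≤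
      p.g t j ω (N.v p t j ω - z) := by
    have hsub := hg z hzO
    rw [← neg_sub (N.v p t j ω) z, map_neg] at hsub
    linarith
  have hv_near := mul_le_mul_of_nonneg_left
    (add_le_add (h.norm_x_sub_v_le t i j ω) (h.norm_u_sub_u_le t i j ω)) h.L_nonneg
  have hu_near := mul_le_mul_of_nonneg_left (h.norm_u_sub_u_le t j i ω) h.L_nonneg
  rw [sub_self, norm_zero, zero_add] at hz'
  linarith

theorem IsNetworkRun.ae_mul_avgCost_sub_le (h : IsNetworkRun N p q P ξ α ℱ Y η B L ν) {z : E}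
    (hz : z ∈ N.X) (t : ℕ) (i : Fin n) :
    ∀ᵐ ω ∂P, n * (N.avgCost P ξ (p.x t i ω) (N.u q t i ω) - N.avgCost P ξ z (N.u q t i ω)) ≤
      ∑ j, p.g t j ω (N.v p t j ω - z) +
        n * (L * (p.disagreement t ω + 2 * q.disagreement t ω)) := by
  have hn : (n : ℝ) ≠ 0 := Nat.cast_ne_zero.2 i.pos.ne'
  filter_upwards [ae_all_iff.2 fun j => h.unbiased.g_sub t j] with ω hω
  have hsum := Finset.sum_le_sum fun j (_ : j ∈ Finset.univ) => h.cost_sub_cost_le hz i j (hω j)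
  rw [Finset.sum_sub_distrib, Finset.sum_add_distrib, Finset.sum_const, Finset.card_univ,
    Fintype.card_fin, nsmul_eq_mul] at hsum
  rwa [Network.avgCost, Network.avgCost, ← mul_sub, ← mul_assoc, mul_one_div_cancel hn, one_mul]

theorem IsNetworkRun.exists_norm_v_sub_le (h : IsNetworkRun N p q P ξ α ℱ Y η B L ν) (z : E)
    (t : ℕ) (i : Fin n) : ∃ C, ∀ ω, ‖N.v p t i ω - z‖ ≤ C := by
  obtain ⟨C, hC⟩ := h.adm.X_compact.exists_bound_of_continuousOn (f := fun x : E => x - z)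
    (by fun_prop)
  exact ⟨C, fun ω => hC _ (h.v_mem t i ω)⟩

section ExpectedLinearizedRegret

variable [SecondCountableTopology E] [BorelSpace E]

theorem IsNetworkRun.adapted_v_sub (h : IsNetworkRun N p q P ξ α ℱ Y η B L ν) (z : E) (t : ℕ)
    (i : Fin n) : Measurable[ℱ t] fun ω => N.v p t i ω - z :=
  (measurable_sum_smul (N.W t i) (h.x_adapted t)).sub_const z

theorem IsNetworkRun.integrable_gHat_apply (h : IsNetworkRun N p q P ξ α ℱ Y η B L ν) (z : E)
    (t : ℕ) (i : Fin n) : Integrable (fun ω => p.gHat t i ω (N.v p t i ω - z)) P :=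
  have ⟨_, hC⟩ := h.exists_norm_v_sub_le z t i
  integrable_clm_apply (h.unbiased.gHat_int t i)
    ((h.adapted_v_sub z t i).mono (h.info_le t) le_rfl) hC

theorem IsNetworkRun.integrable_g_apply (h : IsNetworkRun N p q P ξ α ℱ Y η B L ν) (z : E)
    (t : ℕ) (i : Fin n) : Integrable (fun ω => p.g t i ω (N.v p t i ω - z)) P :=
  have ⟨_, hC⟩ := h.exists_norm_v_sub_le z t i
  integrable_clm_apply (integrable_condExp.congr (h.unbiased.unbiased t i))
    ((h.adapted_v_sub z t i).mono (h.info_le t) le_rfl) hC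

theorem IsNetworkRun.integrable_linearizedRegret (h : IsNetworkRun N p q P ξ α ℱ Y η B L ν) (z : E)
    (t : ℕ) : Integrable (N.linearizedRegret p z t) P :=
  integrable_finsetSum _ fun j _ => h.integrable_gHat_apply z t j

theorem IsNetworkRun.integral_linearizedRegret [IsFiniteMeasure P]
    (h : IsNetworkRun N p q P ξ α ℱ Y η B L ν) (z : E) (t : ℕ) :
    ∫ ω, N.linearizedRegret p z t ω ∂P = ∫ ω, ∑ j, p.g t j ω (N.v p t j ω - z) ∂P := by
  simp only [Network.linearizedRegret]
  rw [integral_finsetSum _ fun j _ => h.integrable_gHat_apply z t j,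
    integral_finsetSum _ fun j _ => h.integrable_g_apply z t j]
  refine Finset.sum_congr rfl fun j _ => ?_
  obtain ⟨_, hC⟩ := h.exists_norm_v_sub_le z t j
  exact integral_clm_apply_eq_of_condExp (h.info_le t) (h.unbiased.gHat_int t j)
    (h.unbiased.unbiased t j) (h.adapted_v_sub z t j) hC

theorem IsNetworkRun.sum_integral_linearizedRegret_le [IsProbabilityMeasure P]
    (h : IsNetworkRun N p q P ξ α ℱ Y η B L ν)
    (hdiam : ∀ x ∈ N.X, ∀ x' ∈ N.X, bregman N.X N.reg x x' ≤ R) (hα : Antitone α)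
    (hpos : ∀ t, 0 < α t) {z : E} (hz : z ∈ N.X) {T : ℕ} (hT : 1 ≤ T) :
    ∑ t ∈ Finset.Icc 1 T, ∫ ω, N.linearizedRegret p z t ω ∂P ≤
      n * (R / α T + (L ^ 2 + ν ^ 2) * ∑ t ∈ Finset.Icc 1 T, α t) := by
  have hsq : ∀ t, Integrable (fun ω => α t * (1 / 2 * ∑ j, ‖p.gHat t j ω‖ ^ 2)) P := fun t =>
    ((integrable_finsetSum _ fun j _ => h.integrable_sq_norm_gHat t j).const_mul _).const_mul _
  have hsq_le : ∀ t, ∫ ω, α t * (1 / 2 * ∑ j, ‖p.gHat t j ω‖ ^ 2) ∂P ≤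
      n * (L ^ 2 + ν ^ 2) * α t := fun t => by
    have hsum := Finset.sum_le_card_nsmul Finset.univ _ _ fun j _ =>
      h.integral_sq_norm_gHat_le t j
    rw [Finset.card_univ, Fintype.card_fin, nsmul_eq_mul] at hsum
    rw [integral_const_mul, integral_const_mul,
      integral_finsetSum _ fun j _ => h.integrable_sq_norm_gHat t j, mul_comm (_ * _)]
    exact mul_le_mul_of_nonneg_left (by linarith) (hpos t).le
  rw [← integral_finsetSum _ fun t _ => h.integrable_linearizedRegret z t]
  calc ∫ ω, ∑ t ∈ Finset.Icc 1 T, N.linearizedRegret p z t ω ∂P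
      ≤ ∫ ω, (n * R / α T +
          ∑ t ∈ Finset.Icc 1 T, α t * (1 / 2 * ∑ j, ‖p.gHat t j ω‖ ^ 2)) ∂P :=
        integral_mono (integrable_finsetSum _ fun t _ => h.integrable_linearizedRegret z t)
          ((integrable_const _).add (integrable_finsetSum _ fun t _ => hsq t))
          (h.sum_linearizedRegret_le hdiam hα hpos hz hT)
    _ = n * R / α T +
          ∑ t ∈ Finset.Icc 1 T, ∫ ω, α t * (1 / 2 * ∑ j, ‖p.gHat t j ω‖ ^ 2) ∂P := by
        rw [integral_add (integrable_const _) (integrable_finsetSum _ fun t _ => hsq t),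
          integral_const, probReal_univ, one_smul, integral_finsetSum _ fun t _ => hsq t]
    _ ≤ n * R / α T + ∑ t ∈ Finset.Icc 1 T, n * (L ^ 2 + ν ^ 2) * α t := by
        gcongr with t
        exact hsq_le t
    _ = n * (R / α T + (L ^ 2 + ν ^ 2) * ∑ t ∈ Finset.Icc 1 T, α t) := by
        rw [← Finset.mul_sum]
        ring

end ExpectedLinearizedRegret

section ExpectedRegret

variable [SecondCountableTopology F] [BorelSpace F]

theorem IsNetworkRun.integrable_opp_disagreement [IsFiniteMeasure P]
    (h : IsNetworkRun N p q P ξ α ℱ Y η B L ν) (t : ℕ) : Integrable (q.disagreement t) P :=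
  integrable_diam_range h.opp_compact (h.measurable_opp t) (h.opp_mem t)

variable [BorelSpace E]

theorem IsNetworkRun.integrable_avgCost [IsFiniteMeasure P]
    (h : IsNetworkRun N p q P ξ α ℱ Y η B L ν) {x : Ω → E} (hx : Measurable x)
    (hxX : ∀ ω, x ω ∈ N.X) (t : ℕ) (i : Fin n) :
    Integrable (fun ω => N.avgCost P ξ (x ω) (N.u q t i ω)) P :=
  integrable_comp_of_continuousOn (h.adm.X_compact.prod h.opp_compact)
    (h.adm.continuousOn_avgCost h.L_nonneg)
    (hx.prodMk (measurable_sum_smul (N.crossW t i) (h.measurable_opp t)))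
    fun ω => ⟨hxX ω, h.u_mem t i ω⟩

theorem IsNetworkRun.integrable_avgCost_const [IsFiniteMeasure P]
    (h : IsNetworkRun N p q P ξ α ℱ Y η B L ν) {z : E} (hz : z ∈ N.X) (t : ℕ) (i : Fin n) :
    Integrable (fun ω => N.avgCost P ξ z (N.u q t i ω)) P :=
  h.integrable_avgCost measurable_const (fun _ => hz) t i

theorem IsNetworkRun.integrable_avgCost_x [IsFiniteMeasure P]
    (h : IsNetworkRun N p q P ξ α ℱ Y η B L ν) (t : ℕ) (i : Fin n) :
    Integrable (fun ω => N.avgCost P ξ (p.x t i ω) (N.u q t i ω)) P :=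
  h.integrable_avgCost (h.measurable_x t i) (h.run.x_mem t i) t i

variable [SecondCountableTopology E] [IsProbabilityMeasure P]

theorem IsNetworkRun.mul_integral_avgCost_sub_le (h : IsNetworkRun N p q P ξ α ℱ Y η B L ν) {z : E}
    (hz : z ∈ N.X) (t : ℕ) (i : Fin n) :
    n * ((∫ ω, N.avgCost P ξ (p.x t i ω) (N.u q t i ω) ∂P) -
        ∫ ω, N.avgCost P ξ z (N.u q t i ω) ∂P) ≤
      ∫ ω, N.linearizedRegret p z t ω ∂P +
        n * (L * (∫ ω, p.disagreement t ω ∂P + 2 * ∫ ω, q.disagreement t ω ∂P)) := by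
  have hp := h.integrable_disagreement t
  have hq := (h.integrable_opp_disagreement t).const_mul 2
  have hD := ((hp.add hq).const_mul L).const_mul (n : ℝ)
  have hg := integrable_finsetSum Finset.univ fun j _ => h.integrable_g_apply z t j
  have hle := integral_mono_ae
    (((h.integrable_avgCost_x t i).sub (h.integrable_avgCost_const hz t i)).const_mul (n : ℝ))
    (hg.add hD) (h.ae_mul_avgCost_sub_le hz t i)
  rw [integral_add' hg hD] at hle
  simp only [integral_const_mul] at hle
  rwa [integral_sub' (h.integrable_avgCost_x t i) (h.integrable_avgCost_const hz t i),
    integral_add' hp hq, integral_const_mul, ← h.integral_linearizedRegret z t] at hle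

theorem IsNetworkRun.sum_integral_avgCost_sub_le (h : IsNetworkRun N p q P ξ α ℱ Y η B L ν)
    (hdiam : ∀ x ∈ N.X, ∀ x' ∈ N.X, bregman N.X N.reg x x' ≤ R) (hα : Antitone α)
    (hpos : ∀ t, 0 < α t) {z : E} (hz : z ∈ N.X) {T : ℕ} (hT : 1 ≤ T) (i : Fin n) :
    ∑ t ∈ Finset.Icc 1 T, ((∫ ω, N.avgCost P ξ (p.x t i ω) (N.u q t i ω) ∂P) -
        ∫ ω, N.avgCost P ξ z (N.u q t i ω) ∂P) ≤
      R / α T + (L ^ 2 + ν ^ 2) * ∑ t ∈ Finset.Icc 1 T, α t +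
      L * (∑ t ∈ Finset.Icc 1 T, ∫ ω, p.disagreement t ω ∂P +
        2 * ∑ t ∈ Finset.Icc 1 T, ∫ ω, q.disagreement t ω ∂P) := by
  have hn : (0 : ℝ) < n := Nat.cast_pos.2 i.pos
  rw [← mul_le_mul_iff_right₀ hn, Finset.mul_sum, mul_add]
  refine (Finset.sum_le_sum fun t _ => h.mul_integral_avgCost_sub_le hz t i).trans ?_
  rw [Finset.sum_add_distrib, ← Finset.mul_sum, ← Finset.mul_sum, Finset.sum_add_distrib,
    ← Finset.mul_sum]
  gcongr
  exact h.sum_integral_linearizedRegret_le hdiam hα hpos hz hT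

end ExpectedRegret

end Regret

section PseudoRegret

variable {Ω : Type w} [MeasurableSpace Ω] {E : Type u} [NormedAddCommGroup E] [NormedSpace ℝ E]
  [MeasurableSpace E] [BorelSpace E] {F : Type v} [NormedAddCommGroup F] [NormedSpace ℝ F]
  [MeasurableSpace F] [BorelSpace F] [SecondCountableTopology F] {n m d : ℕ}
  {N : Network E F n m d} {p : Iterates Ω E n d} {q : Iterates Ω F m d} {P : Measure Ω}
  [IsProbabilityMeasure P] {ξ : Ω → (Fin d → ℝ)} {α : ℕ → ℝ} {ℱ : ℕ → MeasurableSpace Ω}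
  {Y : Set F} {η L ν R : ℝ} {B : ℕ}

theorem IsNetworkRun.continuousOn_integral_fixedCost (h : IsNetworkRun N p q P ξ α ℱ Y η B L ν)
    (i : Fin n) (T : ℕ) : ContinuousOn (fun x => ∫ ω, fixedCost N q P ξ i T x ω ∂P) N.X := by
  have hcont := h.adm.continuousOn_avgCost h.L_nonneg
  obtain ⟨C, hC⟩ := (h.adm.X_compact.prod h.opp_compact).exists_bound_of_continuousOn hcont
  have hcost : ∀ t ω, ContinuousOn (fun x => N.avgCost P ξ x (N.u q t i ω)) N.X := fun t ω =>
    hcont.comp (f := fun x : E => (x, N.u q t i ω)) (by fun_prop) fun x hx => ⟨hx, h.u_mem t i ω⟩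
  exact continuousOn_of_dominated (bound := fun _ => ∑ _t ∈ Finset.Icc 1 T, C)
    (fun x hx => (integrable_finsetSum _ fun t _ =>
      h.integrable_avgCost_const hx t i).aestronglyMeasurable)
    (fun x hx => Eventually.of_forall fun ω => norm_sum_le_of_le _ fun t _ =>
      hC (x, N.u q t i ω) ⟨hx, h.u_mem t i ω⟩)
    (integrable_const _)
    (Eventually.of_forall fun ω => continuousOn_finsetSum _ fun t _ => hcost t ω)

theorem IsNetworkRun.regretExists (h : IsNetworkRun N p q P ξ α ℱ Y η B L ν) (i : Fin n) (T : ℕ) :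
    RegretExists N p q P ξ i T := by
  obtain ⟨ω⟩ : Nonempty Ω := P.nonempty_of_neZero
  exact ⟨integrable_finsetSum _ fun t _ => h.integrable_avgCost_x t i,
    fun z hz => integrable_finsetSum _ fun t _ => h.integrable_avgCost_const hz t i,
    h.adm.X_compact.exists_isMinOn ⟨_, h.run.x_mem 0 i ω⟩ (h.continuousOn_integral_fixedCost i T)⟩

theorem IsNetworkRun.pseudoRegret_le [SecondCountableTopology E]
    (h : IsNetworkRun N p q P ξ α ℱ Y η B L ν)
    (hdiam : ∀ x ∈ N.X, ∀ x' ∈ N.X, bregman N.X N.reg x x' ≤ R) (hα : Antitone α)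
    (hpos : ∀ t, 0 < α t) (i : Fin n) {T : ℕ} (hT : 1 ≤ T) :
    pseudoRegret N p q P ξ i T ≤ R / α T + (L ^ 2 + ν ^ 2) * ∑ t ∈ Finset.Icc 1 T, α t +
      L * (∑ t ∈ Finset.Icc 1 T, ∫ ω, p.disagreement t ω ∂P +
        2 * ∑ t ∈ Finset.Icc 1 T, ∫ ω, q.disagreement t ω ∂P) := by
  obtain ⟨-, -, z, hz, hmin⟩ := h.regretExists i T
  have hleast : IsLeast ((fun x => ∫ ω, fixedCost N q P ξ i T x ω ∂P) '' N.X)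
      (∫ ω, fixedCost N q P ξ i T z ω ∂P) :=
    ⟨Set.mem_image_of_mem _ hz, Set.forall_mem_image.2 fun _ hx => hmin hx⟩
  refine le_trans (le_of_eq ?_) (h.sum_integral_avgCost_sub_le hdiam hα hpos hz hT i)
  rw [pseudoRegret, hleast.csInf_eq, Finset.sum_sub_distrib]
  simp only [playedCost, fixedCost]
  rw [integral_finsetSum _ fun t _ => h.integrable_avgCost_x t i,
    integral_finsetSum _ fun t _ => h.integrable_avgCost_const hz t i]

end PseudoRegret

section Information

variable {Ω : Type w} {E₁ : Type u} [NormedAddCommGroup E₁] [NormedSpace ℝ E₁] [MeasurableSpace E₁]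
  {E₂ : Type v} [NormedAddCommGroup E₂] [NormedSpace ℝ E₂] [MeasurableSpace E₂] {n₁ n₂ d : ℕ}

theorem info_mono (p₁ : Iterates Ω E₁ n₁ d) (p₂ : Iterates Ω E₂ n₂ d) : Monotone (info p₁ p₂) := by
  intro s t hst
  refine sup_le_sup (sup_le_sup le_rfl (iSup_le fun r => ?_)) (iSup_le fun r => ?_)
  · exact le_iSup (fun r : Fin t => ⨆ i, MeasurableSpace.comap (p₁.ξ r i) inferInstance)
      (Fin.castLE hst r)
  · exact le_iSup (fun r : Fin t => ⨆ j, MeasurableSpace.comap (p₂.ξ r j) inferInstance)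
      (Fin.castLE hst r)

theorem measurable_info_left (p₁ : Iterates Ω E₁ n₁ d) (p₂ : Iterates Ω E₂ n₂ d) (i : Fin n₁) :
    Measurable[info p₁ p₂ 0] (p₁.x 0 i) :=
  Measurable.of_comap_le <|
    (le_iSup (fun i => MeasurableSpace.comap (p₁.x 0 i) inferInstance) i).trans
      (le_sup_left.trans (le_sup_left.trans le_sup_left))

theorem measurable_info_right (p₁ : Iterates Ω E₁ n₁ d) (p₂ : Iterates Ω E₂ n₂ d) (j : Fin n₂) :
    Measurable[info p₁ p₂ 0] (p₂.x 0 j) :=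
  Measurable.of_comap_le <|
    (le_iSup (fun j => MeasurableSpace.comap (p₂.x 0 j) inferInstance) j).trans
      (le_sup_right.trans (le_sup_left.trans le_sup_left))

end Information

section RegretBound

/-- A bound on the pseudo regret of an agent of the first network, over a period in which the step
sizes add up to `S` and the last of them is `a`. -/
noncomputable def regretBound (n₁ n₂ B₁ B₂ : ℕ) (η L ν₁ ν₂ Λ₁ Λ₂ R a S : ℝ) : ℝ :=
  R / a + (L ^ 2 + ν₁ ^ 2) * S +
    L * (disagreementBound n₁ B₁ η L ν₁ Λ₁ S + 2 * disagreementBound n₂ B₂ η L ν₂ Λ₂ S)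

theorem disagreementBound_le_mul {n B : ℕ} {η L ν Λ S c r : ℝ} (hη : 0 ≤ η) (hΛ : 0 ≤ Λ)
    (hr : 1 ≤ r) (hS : S ≤ c * r) :
    disagreementBound n B η L ν Λ S ≤ disagreementBound n B η L ν Λ c * r := by
  have hK := subgradientBound_nonneg n L ν
  have hdrift : Λ + ((n * B : ℕ) + 1) * (subgradientBound n L ν * S) ≤
      (Λ + ((n * B : ℕ) + 1) * (subgradientBound n L ν * c)) * r := by
    have := le_mul_of_one_le_right hΛ hr
    calc Λ + ((n * B : ℕ) + 1) * (subgradientBound n L ν * S)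
        ≤ Λ * r + ((n * B : ℕ) + 1) * (subgradientBound n L ν * (c * r)) := by gcongr
      _ = (Λ + ((n * B : ℕ) + 1) * (subgradientBound n L ν * c)) * r := by ring
  rw [disagreementBound, disagreementBound, div_mul_eq_mul_div, mul_assoc _ _ r]
  gcongr

theorem regretBound_le_mul {n₁ n₂ B₁ B₂ : ℕ} {η L ν₁ ν₂ Λ₁ Λ₂ R a S c r : ℝ} (hη : 0 ≤ η)
    (hL : 0 ≤ L) (hΛ₁ : 0 ≤ Λ₁) (hΛ₂ : 0 ≤ Λ₂) (ha : 1 / a = r) (hr : 1 ≤ r) (hS : S ≤ c * r) :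
    regretBound n₁ n₂ B₁ B₂ η L ν₁ ν₂ Λ₁ Λ₂ R a S ≤
      regretBound n₁ n₂ B₁ B₂ η L ν₁ ν₂ Λ₁ Λ₂ R 1 c * r := by
  have hnoise := mul_le_mul_of_nonneg_left hS (by positivity : 0 ≤ L ^ 2 + ν₁ ^ 2)
  have hdis₁ := mul_le_mul_of_nonneg_left
    (disagreementBound_le_mul (n := n₁) (B := B₁) (L := L) (ν := ν₁) hη hΛ₁ hr hS) hL
  have hdis₂ := mul_le_mul_of_nonneg_left
    (disagreementBound_le_mul (n := n₂) (B := B₂) (L := L) (ν := ν₂) hη hΛ₂ hr hS) hL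
  rw [regretBound, regretBound, div_one, div_eq_mul_one_div, ha]
  linarith

end RegretBound

section Game

variable {Ω : Type w} [MeasurableSpace Ω] {E₁ : Type u} [NormedAddCommGroup E₁] [NormedSpace ℝ E₁]
  [MeasurableSpace E₁] {E₂ : Type v} [NormedAddCommGroup E₂] [NormedSpace ℝ E₂] [MeasurableSpace E₂]
  {n₁ n₂ d : ℕ} {N₁ : Network E₁ E₂ n₁ n₂ d} {N₂ : Network E₂ E₁ n₂ n₁ d} {p₁ : Iterates Ω E₁ n₁ d}
  {p₂ : Iterates Ω E₂ n₂ d} {P : Measure Ω} {ξ : Ω → (Fin d → ℝ)} {B₁ B₂ : ℕ}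
  {η L ν₁ ν₂ Λ₁ Λ₂ R : ℝ} {α : ℕ → ℝ}

theorem IsGameRun.nonempty_opponents (h : IsGameRun N₁ N₂ p₁ p₂ P ξ B₁ B₂ η L ν₁ ν₂ Λ₁ Λ₂ R α)
    (i : Fin n₁) : Nonempty (Fin n₂) := by
  by_contra hempty
  rw [not_nonempty_iff] at hempty
  simpa using h.adm₁.cross.row_sum 0 i

theorem IsGameRun.info_le (h : IsGameRun N₁ N₂ p₁ p₂ P ξ B₁ B₂ η L ν₁ ν₂ Λ₁ Λ₂ R α) (t : ℕ) :
    info p₁ p₂ t ≤ ‹MeasurableSpace Ω› := by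
  refine sup_le (sup_le (sup_le ?_ ?_) ?_) ?_
  · exact iSup_le fun i => (h.run₁.init_meas i).comap_le
  · exact iSup_le fun j => (h.run₂.init_meas j).comap_le
  · exact iSup_le fun s => iSup_le fun i => (h.run₁.sample_meas s i).comap_le
  · exact iSup_le fun s => iSup_le fun j => (h.run₂.sample_meas s j).comap_le

variable [BorelSpace E₁] [SecondCountableTopology E₁] [BorelSpace E₂] [SecondCountableTopology E₂]

theorem IsGameRun.isNetworkRun_left (h : IsGameRun N₁ N₂ p₁ p₂ P ξ B₁ B₂ η L ν₁ ν₂ Λ₁ Λ₂ R α)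
    (hη : 0 ≤ η) (hL : 0 ≤ L) :
    IsNetworkRun N₁ p₁ p₂ P ξ α (info p₁ p₂) N₂.X η B₁ L ν₁ where
  η_nonneg := hη
  L_nonneg := hL
  adm := h.adm₁
  run := h.run₁
  unbiased := h.unbiased₁
  info_le := h.info_le
  x_adapted := h.run₁.measurable_x h.adm₁ hη (info_mono p₁ p₂) (measurable_info_left p₁ p₂)
  opp_compact := h.adm₂.X_compact
  opp_convex := h.adm₂.X_convex
  opp_mem := h.run₂.x_mem
  opp_adapted := h.run₂.measurable_x h.adm₂ hη (info_mono p₁ p₂) (measurable_info_right p₁ p₂)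

theorem IsGameRun.isNetworkRun_right (h : IsGameRun N₁ N₂ p₁ p₂ P ξ B₁ B₂ η L ν₁ ν₂ Λ₁ Λ₂ R α)
    (hη : 0 ≤ η) (hL : 0 ≤ L) :
    IsNetworkRun N₂ p₂ p₁ P ξ α (info p₁ p₂) N₁.X η B₂ L ν₂ where
  η_nonneg := hη
  L_nonneg := hL
  adm := h.adm₂
  run := h.run₂
  unbiased := h.unbiased₂
  info_le := h.info_le
  x_adapted := h.run₂.measurable_x h.adm₂ hη (info_mono p₁ p₂) (measurable_info_right p₁ p₂)
  opp_compact := h.adm₁.X_compact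
  opp_convex := h.adm₁.X_convex
  opp_mem := h.run₁.x_mem
  opp_adapted := h.run₁.measurable_x h.adm₁ hη (info_mono p₁ p₂) (measurable_info_left p₁ p₂)

theorem IsGameRun.pseudoRegret_le [IsProbabilityMeasure P]
    (h : IsGameRun N₁ N₂ p₁ p₂ P ξ B₁ B₂ η L ν₁ ν₂ Λ₁ Λ₂ R α) (hη : 0 < η) (hL : 0 ≤ L)
    (hα : Antitone α) (hpos : ∀ t, 0 < α t) (i : Fin n₁) {T : ℕ} (hT : 1 ≤ T) :
    pseudoRegret N₁ p₁ p₂ P ξ i T ≤ regretBound n₁ n₂ B₁ B₂ η L ν₁ ν₂ Λ₁ Λ₂ R (α T)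
      (∑ t ∈ Finset.range (T + 1), α t) := by
  have h₁ := h.isNetworkRun_left hη.le hL
  have h₂ := h.isNetworkRun_right hη.le hL
  have := h.nonempty_opponents i
  have : Nonempty (Fin n₁) := ⟨i⟩
  have hdrop : ∀ f : ℕ → ℝ, (∀ t, 0 ≤ f t) →
      ∑ t ∈ Finset.Icc 1 T, f t ≤ ∑ t ∈ Finset.range (T + 1), f t := fun f hf =>
    Finset.sum_le_sum_of_subset_of_nonneg (fun t ht => by
      simp only [Finset.mem_Icc, Finset.mem_range] at ht ⊢; omega) fun t _ _ => hf t
  have hsteps := hdrop α fun t => (hpos t).le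
  have hdis₁ := (hdrop _ fun t => integral_nonneg fun ω => Metric.diam_nonneg).trans
    (h₁.sum_integral_disagreement_le hη hα (fun t => (hpos t).le) h.init₁ T)
  have hdis₂ := (hdrop _ fun t => integral_nonneg fun ω => Metric.diam_nonneg).trans
    (h₂.sum_integral_disagreement_le hη hα (fun t => (hpos t).le) h.init₂ T)
  refine (h₁.pseudoRegret_le h.diam hα hpos i hT).trans ?_
  rw [regretBound]
  gcongr
  exacts [hdis₁, hdis₂]

end Game

section PowerStepSizes

variable {α : ℕ → ℝ} {s : ℝ}

theorem pos_of_antitone_of_eq_rpow_neg (hα : Antitone α)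
    (hα' : ∀ t : ℕ, 1 ≤ t → α t = (t : ℝ) ^ (-s)) (t : ℕ) : 0 < α t := by
  refine lt_of_lt_of_le ?_ (hα t.le_succ)
  rw [hα' (t + 1) (Nat.le_add_left 1 t)]
  positivity

theorem sum_range_le_mul_rpow (hs : 1 / 2 ≤ s) (hα0 : 0 ≤ α 0)
    (hα' : ∀ t : ℕ, 1 ≤ t → α t = (t : ℝ) ^ (-s)) {T : ℕ} (hT : 1 ≤ T) :
    ∑ t ∈ Finset.range (T + 1), α t ≤ (α 0 + 2) * (T : ℝ) ^ s := by
  have hT' : (1 : ℝ) ≤ T := Nat.one_le_cast.2 hT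
  have hle_sqrt : ∀ t : ℕ, 1 ≤ t → α t ≤ 1 / √(t : ℝ) := fun t ht => by
    rw [hα' t ht, Real.sqrt_eq_rpow, one_div (_ ^ _), ← Real.rpow_neg (Nat.cast_nonneg t)]
    exact Real.rpow_le_rpow_of_exponent_le (Nat.one_le_cast.2 ht) (neg_le_neg hs)
  have hsqrt_le : √(T : ℝ) ≤ (T : ℝ) ^ s := by
    rw [Real.sqrt_eq_rpow]
    exact Real.rpow_le_rpow_of_exponent_le hT' hs
  have hα0_le : α 0 ≤ α 0 * (T : ℝ) ^ s :=
    le_mul_of_one_le_right hα0 (Real.one_le_rpow hT' (by linarith))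
  linarith [sum_range_le_add_two_mul_sqrt hle_sqrt T]

end PowerStepSizes

end DSMD


theorem corollary1_general {n₁ n₂ B₁ B₂ d : ℕ} {η L ν₁ ν₂ Λ₁ Λ₂ R s : ℝ} {α : ℕ → ℝ}
    {E₁ : Type u} [NormedAddCommGroup E₁] [NormedSpace ℝ E₁] [SecondCountableTopology E₁]
    [MeasurableSpace E₁] [BorelSpace E₁]
    {E₂ : Type v} [NormedAddCommGroup E₂] [NormedSpace ℝ E₂] [SecondCountableTopology E₂]
    [MeasurableSpace E₂] [BorelSpace E₂]
    {Ω : Type w} [MeasurableSpace Ω] {P : Measure Ω} [IsProbabilityMeasure P]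
    {ξ : Ω → (Fin d → ℝ)}
    {N₁ : DSMD.Network E₁ E₂ n₁ n₂ d} {N₂ : DSMD.Network E₂ E₁ n₂ n₁ d}
    {p₁ : DSMD.Iterates Ω E₁ n₁ d} {p₂ : DSMD.Iterates Ω E₂ n₂ d}
    (hη : 0 < η) (hL : 0 ≤ L) (hs : 1 / 2 ≤ s) (hα : Antitone α)
    (hα' : ∀ t : ℕ, 1 ≤ t → α t = (t : ℝ) ^ (-s))
    (h : DSMD.IsGameRun N₁ N₂ p₁ p₂ P ξ B₁ B₂ η L ν₁ ν₂ Λ₁ Λ₂ R α)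
    (i : Fin n₁) {T : ℕ} (hT : 1 ≤ T) :
    DSMD.RegretExists N₁ p₁ p₂ P ξ i T ∧ DSMD.pseudoRegret N₁ p₁ p₂ P ξ i T ≤
      DSMD.regretBound n₁ n₂ B₁ B₂ η L ν₁ ν₂ Λ₁ Λ₂ R 1 (α 0 + 2) * (T : ℝ) ^ s := by
  have hpos := DSMD.pos_of_antitone_of_eq_rpow_neg hα hα'
  obtain ⟨ω⟩ : Nonempty Ω := P.nonempty_of_neZero
  obtain ⟨j⟩ := h.nonempty_opponents i
  refine ⟨(h.isNetworkRun_left hη.le hL).regretExists i T,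
    (h.pseudoRegret_le hη hL hα hpos i hT).trans ?_⟩
  refine DSMD.regretBound_le_mul hη.le hL ((norm_nonneg _).trans (h.init₁ i ω))
    ((norm_nonneg _).trans (h.init₂ j ω)) ?_
    (Real.one_le_rpow (Nat.one_le_cast.2 hT) (by linarith))
    (DSMD.sum_range_le_mul_rpow hs (hpos 0).le hα' hT)
  rw [hα' T hT, Real.rpow_neg (Nat.cast_nonneg T), one_div, inv_inv]

theorem corollary1 (n₁ n₂ B₁ B₂ : ℕ) (η L ν₁ ν₂ Λ₁ Λ₂ R : ℝ)
    (hη : 0 < η) (hη' : η < 1) (hL : 0 < L) (hν₁ : 0 < ν₁) (hν₂ : 0 < ν₂) :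
    (∀ ε : ℝ, 0 ≤ ε → ε < 1 / 2 → ∀ α : ℕ → ℝ, Antitone α →
      (∀ t : ℕ, 1 ≤ t → α t = (t : ℝ) ^ (-(1 / 2 + ε))) →
      DSMD.RegretOrder.{u, v, w} n₁ n₂ B₁ B₂ η L ν₁ ν₂ Λ₁ Λ₂ R α (fun T => (T : ℝ) ^ (1 / 2 + ε))) ∧
    (∀ α : ℕ → ℝ, Antitone α → (∀ t : ℕ, 1 ≤ t → α t = 1 / √(t : ℝ)) →
      DSMD.RegretOrder.{u, v, w} n₁ n₂ B₁ B₂ η L ν₁ ν₂ Λ₁ Λ₂ R α (fun T => √(T : ℝ))) := by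
  refine ⟨fun ε hε _ α hα hα' =>
    ⟨_, fun _ _ _ _ _ _ _ _ _ _ _ _ _ _ _ _ _ _ _ _ _ _ h i _ hT =>
      corollary1_general hη hL.le (by linarith) hα hα' h i hT⟩, fun α hα hα' => ?_⟩
  simp only [Real.sqrt_eq_rpow, one_div (_ ^ _), ← Real.rpow_neg (Nat.cast_nonneg _)] at hα' ⊢
  exact ⟨_, fun _ _ _ _ _ _ _ _ _ _ _ _ _ _ _ _ _ _ _ _ _ _ h i _ hT =>
    corollary1_general hη hL.le le_rfl hα hα' h i hT⟩
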